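/- **Definitions.** A *convex invariant cone* is an open convex cone $\Gamma\subset\mathbb{R}^n$ with vertex at the origin such that $\Gamma+\Gamma_n\subset\Gamma$, where $\Gamma_n=\{\tau:\tau_i>0\ \forall i\}$, and such that $\Gamma$ is invariant under permutations of the coordinates. Write $\lambda(A)$ for the vector of eigenvalues (in any order) of a real symmetric $n\times n$ matrix $A$, and let $\mathcal{S}_\Gamma=\{A \text{ symmetric}:\lambda(A)\in\Gamma\}$. A map $F:\mathcal{S}_\Gamma\to\mathbb{R}$ is an *elliptic Hessian operator* on $\Gamma$ if $F(A)=f(\lambda(A))$ for a $C^2$ function $f:\Gamma\to\mathbb{R}$ with $\frac{\partial f}{\partial\lambda_i}>0$ on $\Gamma$ for all $i$, and $F(A)>0$, $F(tA)=tF(A)$ for all $A\in\mathcal{S}_\Gamma$, $t>0$. It is *concave* if it is a concave function on $\mathcal{S}_\Gamma$. It satisfies *condition N* with constants $N_1>0$, $N_2\in\mathbb{R}$ if for all $\lambda\in\Gamma$ and $C>0$ with $f(\lambda)=1$ and $\sum_i\frac{\partial f}{\partial\lambda_i}(\lambda)\le C$ one has $\frac{\partial f}{\partial\lambda_i}(\lambda)\ge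 \frac{1}{N_1C^{N_2}}$ for every $i$. A $C^2$ function $u$ on an open set $\Omega\subset\mathbb{R}^n$ is *admissible* if $D^2u(x)\in\mathcal{S}_\Gamma$ for every $x\in\Omega$. An admissible $u$ satisfies *condition D* with constants $D_1,D_2\in\mathbb{R}$ if $F(D^2u)=1$ in $\Omega$ and, for all $x\in\Omega$ and all $i$, writing $\lambda=\lambda(D^2u(x))$, $\lambda_i>D_1$ implies $\frac{\partial f}{\partial\lambda_i}(\lambda)\,\lambda_i\le D_2$. **Theorem.** Let $\Gamma\subset\mathbb{R}^n$ be a convex invariant cone and let $F$ be a concave elliptic Hessian operator on $\Gamma$ satisfying condition N with constants $N_1,N_2$. Let $D_1,D_2,d\in\mathbb{R}$. Then there are constants $\alpha>0$, $\beta>0$ and $C$, depending only on $F$ (hence on $n$ and $\Gamma$), $N_1,N_2,D_1,D_2$ and $d$, such that the following holds. Let $\Omega\subset\mathbb{R}^n$ be a bounded domain (nonempty, open and connected) with $\operatorname{diam}\Omega=d$, and let $u\in C^\infty(\Omega)\cap C^0(\overline\Omega)$ be admissible with $$F(D^2u)=1\ \text{ in }\Omega,\qquad u=0\ \text{ on }\partial\Omega,$$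 and satisfy condition D with constants $D_1,D_2$. Then $u<0$ in $\Omega$ and $$\sup_{\Omega}\Big((-u)+(-u)^{\alpha}|Du|+(-u)^{\beta}|D^2u|\Big)\le C,$$ where $|D^2u|=\big(\sum_{i,j}u_{ij}^2\big)^{1/2}$. -/

import Mathlib

open scoped ContDiff Gradient

noncomputable section

/-- The positive orthant `Γ_n` in `ℝⁿ`. -/
def positiveOrthant (n : ℕ) : Set (Fin n → ℝ) := {τ | ∀ i, 0 < τ i}

/-- A convex invariant cone in `ℝⁿ`: an open convex cone with vertex at the origin which is stable
under adding elements of the positive orthant and under permutations of the coordinates. -/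
structure IsConvexInvariantCone {n : ℕ} (Γ : Set (Fin n → ℝ)) : Prop where
  isOpen : IsOpen Γ
  cone : ∀ v ∈ Γ, ∀ t : ℝ, 0 < t → t • v ∈ Γ
  positivity : ∀ v ∈ Γ, ∀ τ ∈ positiveOrthant n, v + τ ∈ Γ
  invariance : ∀ v ∈ Γ, ∀ σ : Equiv.Perm (Fin n), v ∘ σ ∈ Γ
  convex : Convex ℝ Γ

/-- `A` is a real symmetric matrix and `v` lists its eigenvalues, with multiplicity, in some
(arbitrary) order. For real matrices `IsHermitian` means symmetric. -/
def IsEigenvalueVector {n : ℕ} (A : Matrix (Fin n) (Fin n) ℝ) (v : Fin n → ℝ) : Prop :=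
  ∃ (h : A.IsHermitian) (σ : Equiv.Perm (Fin n)), v = h.eigenvalues ∘ σ

/-- The symmetric matrices with a vector of eigenvalues in `Γ`. -/
def admissibleMatrices {n : ℕ} (Γ : Set (Fin n → ℝ)) : Set (Matrix (Fin n) (Fin n) ℝ) :=
  {A | ∃ v ∈ Γ, IsEigenvalueVector A v}

/-- The partial derivative `∂f/∂λ_i` at `v`. -/
def partialDer {n : ℕ} (f : (Fin n → ℝ) → ℝ) (i : Fin n) (v : Fin n → ℝ) : ℝ :=
  fderiv ℝ f v (Pi.single i 1)

/-- `F` is an elliptic Hessian operator on `Γ`, with `f` its representation as a function of the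
eigenvalues. Only the values of `F` on `admissibleMatrices Γ` and of `f` on `Γ` play a role. -/
structure IsEllipticHessianOperator {n : ℕ} (Γ : Set (Fin n → ℝ))
    (F : Matrix (Fin n) (Fin n) ℝ → ℝ) (f : (Fin n → ℝ) → ℝ) : Prop where
  contDiffOn : ContDiffOn ℝ 2 f Γ
  eq_of_eigenvalues : ∀ A, ∀ v ∈ Γ, IsEigenvalueVector A v → F A = f v
  ellipticity : ∀ v ∈ Γ, ∀ i, 0 < partialDer f i v
  definiteness : ∀ A ∈ admissibleMatrices Γ, 0 < F A
  homogeneity : ∀ A ∈ admissibleMatrices Γ, ∀ t : ℝ, 0 < t → F (t • A) = t * F A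

/-- Concavity of a Hessian operator, as a function of the matrix. -/
def IsConcaveHessianOperator {n : ℕ} (Γ : Set (Fin n → ℝ))
    (F : Matrix (Fin n) (Fin n) ℝ → ℝ) : Prop :=
  ConcaveOn ℝ (admissibleMatrices Γ) F

/-- Condition N with constants `N₁ > 0` and `N₂`. -/
def ConditionN {n : ℕ} (Γ : Set (Fin n → ℝ)) (f : (Fin n → ℝ) → ℝ) (N₁ N₂ : ℝ) : Prop :=
  0 < N₁ ∧ ∀ v ∈ Γ, f v = 1 → ∀ C : ℝ, 0 < C → ∑ i, partialDer f i v ≤ C →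
    ∀ i, 1 / (N₁ * C ^ N₂) ≤ partialDer f i v

/-- The Hessian matrix `D²u(x)`. -/
def hessianMatrix {n : ℕ} (u : EuclideanSpace ℝ (Fin n) → ℝ) (x : EuclideanSpace ℝ (Fin n)) :
    Matrix (Fin n) (Fin n) ℝ :=
  Matrix.of fun i j =>
    fderiv ℝ (fderiv ℝ u) x (EuclideanSpace.single i 1) (EuclideanSpace.single j 1)

/-- The Euclidean norm `|D²u(x)| = (∑ᵢⱼ uᵢⱼ(x)²)^{1/2}`. -/
def hessianNorm {n : ℕ} (u : EuclideanSpace ℝ (Fin n) → ℝ) (x : EuclideanSpace ℝ (Fin n)) : ℝ :=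
  Real.sqrt (∑ i, ∑ j, hessianMatrix u x i j ^ 2)

/-- `u` is an admissible function on `Ω` with respect to `Γ`. -/
def IsAdmissibleOn {n : ℕ} (Γ : Set (Fin n → ℝ)) (u : EuclideanSpace ℝ (Fin n) → ℝ)
    (Ω : Set (EuclideanSpace ℝ (Fin n))) : Prop :=
  ContDiffOn ℝ 2 u Ω ∧ ∀ x ∈ Ω, hessianMatrix u x ∈ admissibleMatrices Γ

/-- Condition D with constants `D₁` and `D₂`, for a function `u` on `Ω`. -/
def ConditionD {n : ℕ} (F : Matrix (Fin n) (Fin n) ℝ → ℝ) (f : (Fin n → ℝ) → ℝ)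
    (u : EuclideanSpace ℝ (Fin n) → ℝ) (Ω : Set (EuclideanSpace ℝ (Fin n))) (D₁ D₂ : ℝ) : Prop :=
  (∀ x ∈ Ω, F (hessianMatrix u x) = 1) ∧
    ∀ x ∈ Ω, ∀ v, IsEigenvalueVector (hessianMatrix u x) v →
      ∀ i, D₁ < v i → partialDer f i v * v i ≤ D₂

end

/-! ### Algebra of concave Hessian operators: eigenvalue vectors, Euler's identity, superadditivity.
-/

section Algebra

variable {n : ℕ}

/-! The core is a minimum principle that replaces differentiation of `F` as a function of matrices.
Concavity and homogeneity give f(w) ≤ ∑ fᵢ(v) wᵢ, and `F` does not decrease when a matrix is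
replaced by its diagonal part in an orthonormal frame. Fix x and let cᵢ be the derivatives of `f` at
the eigenvalues of D²u(x). Then ∑ cᵢ D²u(y)(rᵢ, rᵢ) ≥ 1 for all points y and frames r, with equality
at x in an eigenframe (`le_sum_partialDer`). Stationarity in y is the once differentiated equation.
The second-order condition along a line with a rotating frame is the concavity inequality for third
derivatives (`rotation_inequality`). `IsLinearization` records this together with conditions N and
D, and the estimates use nothing else.

All bounds come from maximum principles. Some eigenvalue is always positive, so u < 0, and
comparison with a paraboloid bounds -u. For the gradient, maximize w^s |Du|² exp(A|y-p|²) with w =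
-u - ε. Where a gradient component is not small, the first-order condition makes the corresponding
eigenvalue large, so condition D bounds cᵢλᵢ. This bounds the trace ∑ cᵢ by a multiple of 1/w.
Condition N then bounds cᵢ from below and D bounds λᵢ, hence |Du|², from above
(`gradient_bound_of_first_order`).

For second derivatives, maximize w^β u_ξξ exp(κ|Du|²/(2Q) + A|y-p|²/2) over points and unit
directions. In directions of small eigenvalues the third-derivative terms are absorbed by the
concavity inequality, in the others by the term κ/Q ∑ cᵢλᵢ². Again the trace is bounded by a
multiple of 1/w, and N and D bound the largest eigenvalue (`trace_bound_of_large_eigenvalue`). The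
negative eigenvalues are controlled by the largest one (`abs_eigenvalue_le`). -/

lemma exists_perm_of_map_univ_eq {ι α : Type*} [Fintype ι] {v w : ι → α}
    (h : Finset.univ.val.map v = Finset.univ.val.map w) : ∃ σ : Equiv.Perm ι, v = w ∘ σ := by
  classical
  have h1 : ∀ c, Nonempty ({i // v i = c} ≃ {i // w i = c}) := by
    intro c
    have h2 := congrArg (Multiset.count c) h
    rw [Multiset.count_map, Multiset.count_map] at h2
    refine ⟨Fintype.equivOfCardEq ?_⟩
    rw [Fintype.card_subtype, Fintype.card_subtype, Finset.card_def, Finset.card_def,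
      Finset.filter_val, Finset.filter_val]
    simpa only [eq_comm] using h2
  have e := fun c => (h1 c).some
  refine ⟨(Equiv.sigmaFiberEquiv v).symm.trans
    ((Equiv.sigmaCongrRight e).trans (Equiv.sigmaFiberEquiv w)), ?_⟩
  ext i
  exact ((e (v i)) ⟨i, rfl⟩).2.symm

open Polynomial in
-- The characteristic polynomial does not see the order of the eigenvalues, so orthogonal
-- conjugation and diagonal matrices can be treated without choosing an ordering.
lemma isEigenvalueVector_iff {A : Matrix (Fin n) (Fin n) ℝ} {v : Fin n → ℝ} :
    IsEigenvalueVector A v ↔ A.IsHermitian ∧ A.charpoly = ∏ i, (X - C (v i)) := by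
  constructor
  · rintro ⟨h, σ, rfl⟩
    refine ⟨h, ?_⟩
    rw [h.charpoly_eq]
    exact (Equiv.prod_comp σ (fun i => (X - C (h.eigenvalues i)))).symm
  · rintro ⟨h, hc⟩
    have h1 := h.roots_charpoly_eq_eigenvalues
    rw [hc, Polynomial.roots_prod _ _ (by simp [Finset.prod_ne_zero_iff, X_sub_C_ne_zero])] at h1
    simp only [roots_X_sub_C, Multiset.bind_singleton] at h1
    obtain ⟨σ, hσ⟩ := exists_perm_of_map_univ_eq h1
    exact ⟨h, σ, hσ⟩

lemma isEigenvalueVector_diagonal (v : Fin n → ℝ) : IsEigenvalueVector (Matrix.diagonal v) v :=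
  isEigenvalueVector_iff.2 ⟨Matrix.isHermitian_diagonal v, Matrix.charpoly_diagonal v⟩

lemma IsEigenvalueVector.conj {A Q : Matrix (Fin n) (Fin n) ℝ} {v : Fin n → ℝ}
    (h : IsEigenvalueVector A v) (hQ : Q * Q.transpose = 1) :
    IsEigenvalueVector (Q.transpose * A * Q) v := by
  rw [isEigenvalueVector_iff] at h ⊢
  refine ⟨?_, ?_⟩
  · have := Matrix.isHermitian_conjTranspose_mul_mul Q h.1
    simpa using this
  · rw [Matrix.mul_assoc, Matrix.charpoly_mul_comm, Matrix.mul_assoc, hQ, Matrix.mul_one, h.2]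

/-- Averaging over all conjugations by diagonal sign matrices kills the off-diagonal entries. -/
lemma sum_sign_conj (B : Matrix (Fin n) (Fin n) ℝ) :
    ∑ s : Fin n → ℤˣ, (1 / (Fintype.card (Fin n → ℤˣ) : ℝ)) •
      ((Matrix.diagonal fun i => ((s i : ℤ) : ℝ)).transpose * B *
        Matrix.diagonal fun i => ((s i : ℤ) : ℝ)) = Matrix.diagonal fun i => B i i := by
  ext i j
  rw [Matrix.sum_apply]
  simp only [Matrix.diagonal_transpose, Matrix.smul_apply, Matrix.mul_diagonal,
    Matrix.diagonal_mul, smul_eq_mul]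
  by_cases hij : i = j
  · subst hij
    have h1 : ∀ s : Fin n → ℤˣ, (((s i : ℤ) : ℝ)) * B i i * ((s i : ℤ) : ℝ) = B i i := by
      intro s
      rcases Int.units_eq_one_or (s i) with h | h <;> simp [h]
    simp only [h1, Finset.sum_const, Finset.card_univ, nsmul_eq_mul, Matrix.diagonal_apply_eq]
    field_simp
  · rw [Matrix.diagonal_apply_ne _ hij]
    set g : (Fin n → ℤˣ) → ℝ := fun s =>
      1 / (Fintype.card (Fin n → ℤˣ) : ℝ) * (((s i : ℤ) : ℝ) * B i j * ((s j : ℤ) : ℝ)) with hg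
    -- Flipping the `i`-th sign leaves the `j`-th alone, hence negates the summand. Reindexing by
    -- this flip shows that the sum equals its own negative.
    have h1 : ∀ s, g ((Equiv.mulLeft (Pi.mulSingle i (-1) : Fin n → ℤˣ)) s) = - g s := by
      intro s
      simp [hg, Pi.mulSingle_eq_of_ne (Ne.symm hij)]
    have h2 := Equiv.sum_comp (Equiv.mulLeft (Pi.mulSingle i (-1) : Fin n → ℤˣ)) g
    simp only [h1, Finset.sum_neg_distrib] at h2
    linarith

variable {Γ : Set (Fin n → ℝ)} {F : Matrix (Fin n) (Fin n) ℝ → ℝ} {f : (Fin n → ℝ) → ℝ}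

lemma IsConvexInvariantCone.mem_of_isEigenvalueVector (hΓ : IsConvexInvariantCone Γ)
    {A : Matrix (Fin n) (Fin n) ℝ} (hA : A ∈ admissibleMatrices Γ) {v : Fin n → ℝ}
    (hv : IsEigenvalueVector A v) : v ∈ Γ := by
  obtain ⟨w, hw, h, σ, rfl⟩ := hA
  obtain ⟨_, τ, rfl⟩ := hv
  have := hΓ.invariance _ hw (σ.symm * τ)
  convert this using 1
  ext i
  simp

/-- Write τ = t v + (τ - t v) with v in the cone and t > 0 so small that the second summand is still
positive. -/
lemma IsConvexInvariantCone.positiveOrthant_subset (hΓ : IsConvexInvariantCone Γ)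
    (hne : Γ.Nonempty) : positiveOrthant n ⊆ Γ := by
  intro τ hτ
  obtain ⟨v, hv⟩ := hne
  obtain ⟨t, ht, hpos⟩ : ∃ t : ℝ, 0 < t ∧ ∀ i, 0 < τ i - t * v i := by
    have h1 : ∀ i, ∀ᶠ t : ℝ in nhdsWithin 0 (Set.Ioi 0), 0 < τ i - t * v i := by
      intro i
      have : Filter.Tendsto (fun t : ℝ => τ i - t * v i) (nhds 0) (nhds (τ i - 0 * v i)) := by
        apply Continuous.tendsto; fun_prop
      exact (this.mono_left nhdsWithin_le_nhds).eventually_const_lt (by simpa using hτ i)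
    have h2 := (Filter.eventually_all.2 h1).and self_mem_nhdsWithin
    obtain ⟨t, h3, h4⟩ := h2.exists
    exact ⟨t, h4, h3⟩
  have := hΓ.positivity _ (hΓ.cone v hv t ht) (fun i => τ i - t * v i) hpos
  convert this using 1
  ext i
  simp

lemma diagonal_mem_admissibleMatrices {v : Fin n → ℝ} (hv : v ∈ Γ) :
    Matrix.diagonal v ∈ admissibleMatrices Γ := ⟨v, hv, isEigenvalueVector_diagonal v⟩

lemma IsEllipticHessianOperator.apply_diagonal (hF : IsEllipticHessianOperator Γ F f)
    {v : Fin n → ℝ} (hv : v ∈ Γ) : F (Matrix.diagonal v) = f v :=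
  hF.eq_of_eigenvalues _ v hv (isEigenvalueVector_diagonal v)

lemma IsEllipticHessianOperator.pos (hF : IsEllipticHessianOperator Γ F f)
    {v : Fin n → ℝ} (hv : v ∈ Γ) : 0 < f v := by
  rw [← hF.apply_diagonal hv]
  exact hF.definiteness _ (diagonal_mem_admissibleMatrices hv)

lemma IsEllipticHessianOperator.map_smul (hF : IsEllipticHessianOperator Γ F f)
    (hΓ : IsConvexInvariantCone Γ) {v : Fin n → ℝ} (hv : v ∈ Γ) {t : ℝ} (ht : 0 < t) :
    f (t • v) = t * f v := by
  rw [← hF.apply_diagonal hv, ← hF.apply_diagonal (hΓ.cone v hv t ht), ← hF.homogeneity _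
    (diagonal_mem_admissibleMatrices hv) t ht]
  congr 1
  ext i j
  simp [Matrix.diagonal_apply]

lemma IsEllipticHessianOperator.hasFDerivAt (hF : IsEllipticHessianOperator Γ F f)
    (hΓ : IsConvexInvariantCone Γ) {v : Fin n → ℝ} (hv : v ∈ Γ) :
    HasFDerivAt f (fderiv ℝ f v) v :=
  ((hF.contDiffOn.contDiffAt (hΓ.isOpen.mem_nhds hv)).differentiableAt (by simp)).hasFDerivAt

lemma fderiv_apply_eq_sum_partialDer (v w : Fin n → ℝ) :
    fderiv ℝ f v w = ∑ i, partialDer f i v * w i := by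
  conv_lhs => rw [pi_eq_sum_univ' w, map_sum]
  refine Finset.sum_congr rfl fun i _ => ?_
  rw [map_smul, smul_eq_mul, mul_comm, partialDer]

lemma IsEllipticHessianOperator.euler (hF : IsEllipticHessianOperator Γ F f)
    (hΓ : IsConvexInvariantCone Γ) {v : Fin n → ℝ} (hv : v ∈ Γ) :
    ∑ i, partialDer f i v * v i = f v := by
  rw [← fderiv_apply_eq_sum_partialDer]
  have h0 := hF.hasFDerivAt hΓ hv
  have h1 : HasDerivAt (fun t : ℝ => f (t • v)) (fderiv ℝ f v v) 1 := by
    have h2 : HasDerivAt (fun t : ℝ => t • v) v 1 := by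
      simpa using (hasDerivAt_id (1 : ℝ)).smul_const v
    have h3 : HasFDerivAt f (fderiv ℝ f v) ((1 : ℝ) • v) := by simpa using h0
    exact h3.comp_hasDerivAt 1 h2
  have h4 : HasDerivAt (fun t : ℝ => f (t • v)) (f v) 1 := by
    have h5 : HasDerivAt (fun t : ℝ => t * f v) (f v) 1 := by
      simpa using (hasDerivAt_id (1 : ℝ)).mul_const (f v)
    refine h5.congr_of_eventuallyEq ?_
    filter_upwards [lt_mem_nhds (zero_lt_one : (0 : ℝ) < 1)] with t ht
    exact hF.map_smul hΓ hv ht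
  exact h1.unique h4

/-- The sum is twice the midpoint, so homogeneity turns concavity into superadditivity. -/
lemma IsEllipticHessianOperator.add_le (hF : IsEllipticHessianOperator Γ F f)
    (hΓ : IsConvexInvariantCone Γ) (hconc : IsConcaveHessianOperator Γ F)
    {v w : Fin n → ℝ} (hv : v ∈ Γ) (hw : w ∈ Γ) : v + w ∈ Γ ∧ f v + f w ≤ f (v + w) := by
  have hmid := hΓ.convex hv hw (a := 1 / 2) (b := 1 / 2) (by norm_num) (by norm_num) (by norm_num)
  have h2 : v + w = (2 : ℝ) • ((1 / 2 : ℝ) • v + (1 / 2 : ℝ) • w) := by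
    rw [smul_add, smul_smul, smul_smul]; norm_num
  have hvw : v + w ∈ Γ := by
    rw [h2]; exact hΓ.cone _ hmid 2 (by norm_num)
  refine ⟨hvw, ?_⟩
  rw [h2, hF.map_smul hΓ hmid (by norm_num : (0 : ℝ) < 2)]
  have h3 := hconc.2 (diagonal_mem_admissibleMatrices hv) (diagonal_mem_admissibleMatrices hw)
    (by norm_num : (0 : ℝ) ≤ 1 / 2) (by norm_num : (0 : ℝ) ≤ 1 / 2) (by norm_num)
  have h4 : (1 / 2 : ℝ) • Matrix.diagonal v + (1 / 2 : ℝ) • Matrix.diagonal w =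
      Matrix.diagonal ((1 / 2 : ℝ) • v + (1 / 2 : ℝ) • w) := by
    ext i j
    by_cases hij : i = j <;> simp [hij]
  rw [h4, hF.apply_diagonal hv, hF.apply_diagonal hw, hF.apply_diagonal hmid] at h3
  simp only [smul_eq_mul] at h3
  linarith

/-- Concavity and homogeneity of degree one give `f w ≤ Df(v) w`. -/
lemma IsEllipticHessianOperator.le_fderiv (hF : IsEllipticHessianOperator Γ F f)
    (hΓ : IsConvexInvariantCone Γ) (hconc : IsConcaveHessianOperator Γ F)
    {v w : Fin n → ℝ} (hv : v ∈ Γ) (hw : w ∈ Γ) : f w ≤ ∑ i, partialDer f i v * w i := by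
  rw [← fderiv_apply_eq_sum_partialDer]
  have h1 : HasDerivAt (fun t : ℝ => f (v + t • w)) (fderiv ℝ f v w) 0 := by
    have h2 : HasDerivAt (fun t : ℝ => v + t • w) w 0 := by
      simpa using ((hasDerivAt_id (0 : ℝ)).smul_const w).const_add v
    have h3 : HasFDerivAt f (fderiv ℝ f v) (v + (0 : ℝ) • w) := by
      simpa using hF.hasFDerivAt hΓ hv
    exact h3.comp_hasDerivAt 0 h2
  have h2 := h1.tendsto_slope_zero_right
  refine ge_of_tendsto h2 ?_
  filter_upwards [self_mem_nhdsWithin] with t ht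
  have ht : 0 < t := ht
  have h3 := (hF.add_le hΓ hconc hv (hΓ.cone w hw t ht)).2
  rw [hF.map_smul hΓ hw ht] at h3
  simp only [zero_add, zero_smul, add_zero, smul_eq_mul]
  rw [inv_mul_eq_div, le_div_iff₀ ht]
  linarith

/-- `F` does not decrease when a matrix is replaced by its diagonal part. -/
lemma IsEllipticHessianOperator.le_diag (hF : IsEllipticHessianOperator Γ F f)
    (hΓ : IsConvexInvariantCone Γ) (hconc : IsConcaveHessianOperator Γ F)
    {B : Matrix (Fin n) (Fin n) ℝ} (hB : B ∈ admissibleMatrices Γ) :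
    (fun i => B i i) ∈ Γ ∧ F B ≤ f fun i => B i i := by
  obtain ⟨v, hv, hBv⟩ := hB
  have hsq : ∀ s : Fin n → ℤˣ, (Matrix.diagonal fun i => ((s i : ℤ) : ℝ)) *
      (Matrix.diagonal fun i => ((s i : ℤ) : ℝ)).transpose = 1 := by
    intro s
    rw [Matrix.diagonal_transpose, Matrix.diagonal_mul_diagonal, ← Matrix.diagonal_one]
    congr 1
    ext i
    rcases Int.units_eq_one_or (s i) with h | h <;> simp [h]
  -- Sign matrices are orthogonal, so `F` takes the same value at all these conjugates. Jensen's
  -- inequality applies to their average, which is the diagonal part of `B`.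
  have hmem : ∀ s : Fin n → ℤˣ, IsEigenvalueVector
      ((Matrix.diagonal fun i => ((s i : ℤ) : ℝ)).transpose * B *
        Matrix.diagonal fun i => ((s i : ℤ) : ℝ)) v := fun s => hBv.conj (hsq s)
  have hw : ∑ _s : Fin n → ℤˣ, (1 / (Fintype.card (Fin n → ℤˣ) : ℝ)) = 1 := by
    rw [Finset.sum_const, Finset.card_univ, nsmul_eq_mul]
    field_simp
  have h1 := hconc.1.sum_mem (t := Finset.univ)
    (w := fun _ : Fin n → ℤˣ => (1 / (Fintype.card (Fin n → ℤˣ) : ℝ)))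
    (fun _ _ => by positivity) hw (fun s _ => ⟨v, hv, hmem s⟩)
  have h2 := hconc.le_map_sum (t := Finset.univ)
    (w := fun _ : Fin n → ℤˣ => (1 / (Fintype.card (Fin n → ℤˣ) : ℝ)))
    (fun _ _ => by positivity) hw (fun s _ => ⟨v, hv, hmem s⟩)
  rw [sum_sign_conj] at h1 h2
  have h3 := hΓ.mem_of_isEigenvalueVector h1 (isEigenvalueVector_diagonal _)
  refine ⟨h3, ?_⟩
  rw [← hF.apply_diagonal h3]
  refine le_trans (le_of_eq ?_) h2
  have h4 : ∀ s : Fin n → ℤˣ, F ((Matrix.diagonal fun i => ((s i : ℤ) : ℝ)).transpose * B *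
        Matrix.diagonal fun i => ((s i : ℤ) : ℝ)) = F B := by
    intro s
    rw [hF.eq_of_eigenvalues _ v hv (hmem s), hF.eq_of_eigenvalues _ v hv hBv]
  simp only [h4, smul_eq_mul]
  rw [← Finset.sum_mul, hw, one_mul]

/-- The linearization of a concave operator at a matrix with eigenvalues `v` dominates the
operator, in every orthonormal frame. -/
theorem IsEllipticHessianOperator.le_sum_partialDer (hF : IsEllipticHessianOperator Γ F f)
    (hΓ : IsConvexInvariantCone Γ) (hconc : IsConcaveHessianOperator Γ F)
    {v : Fin n → ℝ} (hv : v ∈ Γ) {B : Matrix (Fin n) (Fin n) ℝ} (hB : B ∈ admissibleMatrices Γ)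
    (r : OrthonormalBasis (Fin n) ℝ (EuclideanSpace ℝ (Fin n))) :
    F B ≤ ∑ i, partialDer f i v * ∑ k, ∑ l, r i k * r i l * B k l := by
  -- The columns of `Q` are the frame vectors, so the diagonal of QᵀBQ lists the values B(rᵢ, rᵢ).
  set Q : Matrix (Fin n) (Fin n) ℝ := Matrix.of fun k i => r i k with hQdef
  have hQ' : Q.transpose * Q = 1 := by
    ext i j
    have h1 := orthonormal_iff_ite.1 r.orthonormal i j
    rw [PiLp.inner_apply] at h1
    rw [Matrix.mul_apply, Matrix.one_apply, ← h1]
    simp [Q, mul_comm]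
  have hQ : Q * Q.transpose = 1 := mul_eq_one_comm.1 hQ'
  obtain ⟨w, hw, hBw⟩ := hB
  have h1 := hBw.conj hQ
  obtain ⟨h2, h3⟩ := hF.le_diag hΓ hconc ⟨w, hw, h1⟩
  rw [hF.eq_of_eigenvalues _ w hw h1, ← hF.eq_of_eigenvalues _ w hw hBw] at h3
  refine h3.trans ((hF.le_fderiv hΓ hconc hv h2).trans (le_of_eq ?_))
  refine Finset.sum_congr rfl fun i _ => ?_
  congr 1
  simp only [Matrix.mul_apply, Matrix.transpose_apply, Q, Matrix.of_apply, Finset.sum_mul]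
  rw [Finset.sum_comm]
  refine Finset.sum_congr rfl fun k _ => Finset.sum_congr rfl fun l _ => by ring

end Algebra

/-! ### Calculus of second-order jets of functions of one variable. -/

section Jets

open Filter Topology

/-- `g` is twice differentiable at `0`, with value `a` and first two derivatives `b` and `c`. -/
def HasJet (g : ℝ → ℝ) (a b c : ℝ) : Prop :=
  g 0 = a ∧ ∃ g' : ℝ → ℝ, (∀ᶠ t in 𝓝 0, HasDerivAt g (g' t) t) ∧ g' 0 = b ∧ HasDerivAt g' c 0

namespace HasJet

variable {g h : ℝ → ℝ} {a b c a' b' c' : ℝ}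

lemma const (r : ℝ) : HasJet (fun _ => r) r 0 0 :=
  ⟨rfl, fun _ => 0, Eventually.of_forall fun t => hasDerivAt_const t r, rfl, hasDerivAt_const 0 0⟩

lemma add (hg : HasJet g a b c) (hh : HasJet h a' b' c') :
    HasJet (fun t => g t + h t) (a + a') (b + b') (c + c') := by
  obtain ⟨rfl, g', hg', rfl, hg2⟩ := hg
  obtain ⟨rfl, h', hh', rfl, hh2⟩ := hh
  refine ⟨rfl, fun t => g' t + h' t, ?_, rfl, hg2.add hh2⟩
  filter_upwards [hg', hh'] with t h1 h2 using h1.add h2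

lemma mul (hg : HasJet g a b c) (hh : HasJet h a' b' c') :
    HasJet (fun t => g t * h t) (a * a') (b * a' + a * b') (c * a' + 2 * (b * b') + a * c') := by
  obtain ⟨rfl, g', hg', rfl, hg2⟩ := hg
  obtain ⟨rfl, h', hh', rfl, hh2⟩ := hh
  refine ⟨rfl, fun t => g' t * h t + g t * h' t, ?_, rfl, ?_⟩
  · filter_upwards [hg', hh'] with t h1 h2 using h1.mul h2
  · have := (hg2.mul hh'.self_of_nhds).add (hg'.self_of_nhds.mul hh2)
    refine this.congr_deriv ?_
    ring

lemma const_mul (r : ℝ) (hg : HasJet g a b c) :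
    HasJet (fun t => r * g t) (r * a) (r * b) (r * c) := by
  have := (const r).mul hg
  simpa using this

lemma sum {ι : Type*} (s : Finset ι) {g : ι → ℝ → ℝ} {a b c : ι → ℝ}
    (hg : ∀ i ∈ s, HasJet (g i) (a i) (b i) (c i)) :
    HasJet (fun t => ∑ i ∈ s, g i t) (∑ i ∈ s, a i) (∑ i ∈ s, b i) (∑ i ∈ s, c i) := by
  classical
  induction s using Finset.induction_on with
  | empty => simpa using const 0
  | insert i s hi ih =>
    simp only [Finset.sum_insert hi]
    exact (hg i (Finset.mem_insert_self i s)).add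
      (ih fun j hj => hg j (Finset.mem_insert_of_mem hj))

lemma log (hg : HasJet g a b c) (ha : 0 < a) :
    HasJet (fun t => Real.log (g t)) (Real.log a) (b / a) (c / a - b ^ 2 / a ^ 2) := by
  obtain ⟨rfl, g', hg', rfl, hg2⟩ := hg
  refine ⟨rfl, fun t => g' t / g t, ?_, rfl, ?_⟩
  · have hpos := hg'.self_of_nhds.continuousAt.eventually_const_lt ha
    filter_upwards [hg', hpos] with t h1 h2 using h1.log h2.ne'
  · have := hg2.div hg'.self_of_nhds ha.ne'
    refine this.congr_deriv ?_
    field_simp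

lemma congr (hg : HasJet g a b c) (ha : a = a') (hb : b = b') (hc : c = c') :
    HasJet g a' b' c' := by
  subst ha hb hc; exact hg

lemma eq_zero_of_isLocalMax (hg : HasJet g a b c) (hmax : IsLocalMax g 0) : b = 0 := by
  obtain ⟨_, g', hg', rfl, _⟩ := hg
  exact hmax.hasDerivAt_eq_zero hg'.self_of_nhds

/-- If `c` were positive, the second derivative test would make 0 a local minimum as well. Then `g`
would be locally constant and `c` would vanish. -/
lemma nonpos_of_isLocalMax (hg : HasJet g a b c) (hmax : IsLocalMax g 0) : c ≤ 0 := by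
  have hb := hg.eq_zero_of_isLocalMax hmax
  obtain ⟨_, g', hg', rfl, hg2⟩ := hg
  by_contra! hc
  have hd : deriv g =ᶠ[𝓝 0] g' := by
    filter_upwards [hg'] with t ht using ht.deriv
  have hmin : IsLocalMin g 0 := by
    apply isLocalMin_of_deriv_deriv_pos
    · rw [hd.deriv_eq, hg2.deriv]; exact hc
    · rw [hd.self_of_nhds, hb]
    · exact hg'.self_of_nhds.continuousAt
  have heq : ∀ᶠ t in 𝓝 (0 : ℝ), g t = g 0 := by
    filter_upwards [hmin, hmax] with t h1 h2 using le_antisymm h2 h1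
  have hz : ∀ᶠ t in 𝓝 (0 : ℝ), g' t = 0 := by
    filter_upwards [heq.eventually_nhds, hg'] with t h1 h2
    exact h2.unique ((hasDerivAt_const t (g 0)).congr_of_eventuallyEq h1)
  have := hg2.unique ((hasDerivAt_const (0 : ℝ) (0 : ℝ)).congr_of_eventuallyEq hz)
  exact hc.ne' this

lemma eq_zero_of_isLocalMin (hg : HasJet g a b c) (hmin : IsLocalMin g 0) : b = 0 := by
  have := (hg.const_mul (-1)).eq_zero_of_isLocalMax (by simpa using hmin.neg)
  linarith

lemma nonneg_of_isLocalMin (hg : HasJet g a b c) (hmin : IsLocalMin g 0) : 0 ≤ c := by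
  have := (hg.const_mul (-1)).nonpos_of_isLocalMax (by simpa using hmin.neg)
  linarith

end HasJet

end Jets

/-! ### Iterated directional derivatives of smooth functions. -/

section DirectionalDerivative

open Filter Topology

variable {E : Type*} [NormedAddCommGroup E] [NormedSpace ℝ E]

/-- The derivative of `v` in the direction `a`. -/
noncomputable def dirDeriv (a : E) (v : E → ℝ) (x : E) : ℝ := fderiv ℝ v x a

variable {Ω : Set E} {v w : E → ℝ} {x : E}

lemma ContDiffOn.dirDeriv (hΩ : IsOpen Ω) (hv : ContDiffOn ℝ ∞ v Ω) (a : E) :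
    ContDiffOn ℝ ∞ (dirDeriv a v) Ω :=
  (hv.fderiv_of_isOpen hΩ (by simp)).clm_apply contDiffOn_const

lemma ContDiffOn.differentiableAt_of_isOpen (hΩ : IsOpen Ω) (hv : ContDiffOn ℝ ∞ v Ω)
    (hx : x ∈ Ω) : DifferentiableAt ℝ v x :=
  (hv.contDiffAt (hΩ.mem_nhds hx)).differentiableAt (by simp)

lemma dirDeriv_dirDeriv (hΩ : IsOpen Ω) (hv : ContDiffOn ℝ ∞ v Ω) (hx : x ∈ Ω) (a b : E) :
    dirDeriv a (dirDeriv b v) x = fderiv ℝ (fderiv ℝ v) x a b := by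
  have h1 : DifferentiableAt ℝ (fderiv ℝ v) x :=
    ((hv.fderiv_of_isOpen hΩ (m := ∞) (by simp)).contDiffAt (hΩ.mem_nhds hx)).differentiableAt
      (by simp)
  have h2 := h1.hasFDerivAt.clm_apply (hasFDerivAt_const b x)
  have h3 : HasFDerivAt (_root_.dirDeriv b v) _ x := h2
  rw [dirDeriv, h3.fderiv]
  simp

lemma dirDeriv_comm (hΩ : IsOpen Ω) (hv : ContDiffOn ℝ ∞ v Ω) (hx : x ∈ Ω) (a b : E) :
    dirDeriv a (dirDeriv b v) x = dirDeriv b (dirDeriv a v) x := by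
  rw [dirDeriv_dirDeriv hΩ hv hx, dirDeriv_dirDeriv hΩ hv hx]
  exact (hv.contDiffAt (hΩ.mem_nhds hx)).isSymmSndFDerivAt
    (by rw [minSmoothness_of_isRCLikeNormedField]; exact WithTop.coe_le_coe.2 (le_top : (2 : ℕ∞) ≤ ⊤)) a b

lemma dirDeriv_congr (hΩ : IsOpen Ω) (h : ∀ y ∈ Ω, v y = w y) (hx : x ∈ Ω) (a : E) :
    dirDeriv a v x = dirDeriv a w x := by
  have : v =ᶠ[𝓝 x] w := by
    filter_upwards [hΩ.mem_nhds hx] with y hy using h y hy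
  rw [dirDeriv, this.fderiv_eq, dirDeriv]

lemma hasJet_line (hΩ : IsOpen Ω) (hv : ContDiffOn ℝ ∞ v Ω) (hx : x ∈ Ω) (a : E) :
    HasJet (fun t => v (x + t • a)) (v x) (dirDeriv a v x) (dirDeriv a (dirDeriv a v) x) := by
  have key : ∀ w : E → ℝ, ContDiffOn ℝ ∞ w Ω → ∀ t : ℝ, x + t • a ∈ Ω →
      HasDerivAt (fun t => w (x + t • a)) (dirDeriv a w (x + t • a)) t := by
    intro w hw t ht
    have h1 : HasDerivAt (fun t : ℝ => x + t • a) a t := by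
      simpa using ((hasDerivAt_id t).smul_const a).const_add x
    exact (hw.differentiableAt_of_isOpen hΩ ht).hasFDerivAt.comp_hasDerivAt t h1
  refine ⟨by simp, fun t => dirDeriv a v (x + t • a), ?_, by simp, ?_⟩
  · have hc : ContinuousAt (fun t : ℝ => x + t • a) 0 := by fun_prop
    have := hc.preimage_mem_nhds (hΩ.mem_nhds (by simpa using hx))
    filter_upwards [this] with t ht using key v hv t ht
  · have := key _ (hv.dirDeriv hΩ a) 0 (by simpa using hx)
    simpa using this

lemma eventually_line_mem (hΩ : IsOpen Ω) (hx : x ∈ Ω) (a : E) :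
    ∀ᶠ t : ℝ in 𝓝 0, x + t • a ∈ Ω := by
  have hc : ContinuousAt (fun t : ℝ => x + t • a) 0 := by fun_prop
  exact hc.preimage_mem_nhds (hΩ.mem_nhds (by simpa using hx))

end DirectionalDerivative

/-! ### Second-order inequalities from moving a point and rotating a frame. -/

section Rotation

open Filter Topology
open scoped InnerProductSpace

variable {n : ℕ}

/-- A skew-adjoint operator generates a curve of orthonormal bases through a given one. -/
lemma exists_orthonormalBasis_curve {n : ℕ}
    (b : OrthonormalBasis (Fin n) ℝ (EuclideanSpace ℝ (Fin n)))
    (K : EuclideanSpace ℝ (Fin n) →L[ℝ] EuclideanSpace ℝ (Fin n))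
    (hK : K ∈ skewAdjoint (EuclideanSpace ℝ (Fin n) →L[ℝ] EuclideanSpace ℝ (Fin n))) :
    ∃ r : ℝ → OrthonormalBasis (Fin n) ℝ (EuclideanSpace ℝ (Fin n)), ∀ i k,
      HasJet (fun t => ⟪b k, r t i⟫_ℝ) (if k = i then 1 else 0) ⟪b k, K (b i)⟫_ℝ
        ⟪b k, K (K (b i))⟫_ℝ := by
  let _ : NormedAlgebra ℚ (EuclideanSpace ℝ (Fin n) →L[ℝ] EuclideanSpace ℝ (Fin n)) :=
    NormedAlgebra.restrictScalars ℚ ℝ _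
  have hmem : ∀ t : ℝ, NormedSpace.exp (t • K) ∈
      unitary (EuclideanSpace ℝ (Fin n) →L[ℝ] EuclideanSpace ℝ (Fin n)) := fun t =>
    NormedSpace.exp_mem_unitary_of_mem_skewAdjoint (skewAdjoint.smul_mem t hK)
  refine ⟨fun t => b.map (Unitary.linearIsometryEquiv ⟨_, hmem t⟩), fun i k => ?_⟩
  have hval : ∀ t : ℝ, (b.map (Unitary.linearIsometryEquiv ⟨_, hmem t⟩)) i =
      NormedSpace.exp (t • K) (b i) := fun t => by
    rw [OrthonormalBasis.map_apply]; rfl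
  have hder : ∀ (t : ℝ) (x : EuclideanSpace ℝ (Fin n)),
      HasDerivAt (fun t : ℝ => ⟪b k, NormedSpace.exp (t • K) x⟫_ℝ)
        ⟪b k, NormedSpace.exp (t • K) (K x)⟫_ℝ t := by
    intro t x
    have h1 := hasDerivAt_exp_smul_const (𝕂 := ℝ) K t
    have h2 := (h1.clm_apply (hasDerivAt_const t x))
    have h3 := (hasDerivAt_const t (b k)).inner ℝ h2
    simpa using h3
  have h0 : NormedSpace.exp ((0 : ℝ) • K) = 1 :=
    (congrArg NormedSpace.exp (zero_smul ℝ K)).trans NormedSpace.exp_zero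
  refine ⟨?_, fun t => ⟪b k, NormedSpace.exp (t • K) (K (b i))⟫_ℝ, ?_, ?_, ?_⟩
  · refine (congrArg (fun y => ⟪b k, y⟫_ℝ) (hval 0)).trans ?_
    rw [h0]
    exact orthonormal_iff_ite.1 b.orthonormal k i
  · refine Eventually.of_forall fun t => ?_
    exact (hder t (b i)).congr_of_eventuallyEq
      (Eventually.of_forall fun s => congrArg (fun y => ⟪b k, y⟫_ℝ) (hval s))
  · show ⟪b k, NormedSpace.exp ((0 : ℝ) • K) (K (b i))⟫_ℝ = _
    rw [h0]; rfl
  · have h1 := hder 0 (K (b i))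
    rw [h0] at h1
    exact h1

variable {Ω : Set (EuclideanSpace ℝ (Fin n))} {u : EuclideanSpace ℝ (Fin n) → ℝ}
  {x : EuclideanSpace ℝ (Fin n)}

lemma secondDeriv_expand (b : OrthonormalBasis (Fin n) ℝ (EuclideanSpace ℝ (Fin n)))
    (B : EuclideanSpace ℝ (Fin n) →L[ℝ] EuclideanSpace ℝ (Fin n) →L[ℝ] ℝ)
    (y z : EuclideanSpace ℝ (Fin n)) :
    B y z = ∑ k, ∑ l, ⟪b k, y⟫_ℝ * ⟪b l, z⟫_ℝ * B (b k) (b l) := by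
  conv_lhs => rw [← b.sum_repr' y, ← b.sum_repr' z]
  simp only [map_sum, map_smul, sum_apply, smul_apply,
    smul_eq_mul, Finset.mul_sum]
  rw [Finset.sum_comm]
  refine Finset.sum_congr rfl fun k _ => Finset.sum_congr rfl fun l _ => by ring

/-- If `∑ cᵢ D²u(rᵢ, rᵢ)` is minimal at `x` for the frame `b`, its derivatives vanish there. -/
lemma sum_third_deriv_eq_zero (hΩ : IsOpen Ω) (hu : ContDiffOn ℝ ∞ u Ω) (hx : x ∈ Ω)
    (b : OrthonormalBasis (Fin n) ℝ (EuclideanSpace ℝ (Fin n))) {c : Fin n → ℝ}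
    (hle : ∀ y ∈ Ω, 1 ≤ ∑ i, c i * dirDeriv (b i) (dirDeriv (b i) u) y)
    (heq : ∑ i, c i * dirDeriv (b i) (dirDeriv (b i) u) x = 1)
    (a : EuclideanSpace ℝ (Fin n)) :
    ∑ i, c i * dirDeriv a (dirDeriv (b i) (dirDeriv (b i) u)) x = 0 := by
  have hJ := HasJet.sum Finset.univ fun i _ => HasJet.const_mul (c i)
    (hasJet_line hΩ ((hu.dirDeriv hΩ (b i)).dirDeriv hΩ (b i)) hx a)
  refine hJ.eq_zero_of_isLocalMin ?_
  filter_upwards [eventually_line_mem hΩ hx a] with t ht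
  simp only [zero_smul, add_zero, heq]
  exact hle _ ht

lemma inner_skew {K : EuclideanSpace ℝ (Fin n) →L[ℝ] EuclideanSpace ℝ (Fin n)}
    (hK : K ∈ skewAdjoint (EuclideanSpace ℝ (Fin n) →L[ℝ] EuclideanSpace ℝ (Fin n)))
    (y z : EuclideanSpace ℝ (Fin n)) : ⟪y, K z⟫_ℝ = -⟪K y, z⟫_ℝ := by
  have h1 : ContinuousLinearMap.adjoint K = -K := hK
  rw [← ContinuousLinearMap.adjoint_inner_left, h1]
  simp

/-- The second-order inequality obtained by moving along a line and rotating the frame. -/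
lemma rotation_inequality (hΩ : IsOpen Ω) (hu : ContDiffOn ℝ ∞ u Ω) (hx : x ∈ Ω)
    (b : OrthonormalBasis (Fin n) ℝ (EuclideanSpace ℝ (Fin n))) {lam c : Fin n → ℝ}
    (hdiag : ∀ i j, dirDeriv (b i) (dirDeriv (b j) u) x = if i = j then lam i else 0)
    (hle : ∀ y ∈ Ω, ∀ r : OrthonormalBasis (Fin n) ℝ (EuclideanSpace ℝ (Fin n)),
      1 ≤ ∑ i, c i * dirDeriv (r i) (dirDeriv (r i) u) y)
    (heq : ∑ i, c i * lam i = 1)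
    {K : EuclideanSpace ℝ (Fin n) →L[ℝ] EuclideanSpace ℝ (Fin n)}
    (hK : K ∈ skewAdjoint (EuclideanSpace ℝ (Fin n) →L[ℝ] EuclideanSpace ℝ (Fin n)))
    (a : EuclideanSpace ℝ (Fin n)) :
    0 ≤ ∑ i, c i * (dirDeriv a (dirDeriv a (dirDeriv (b i) (dirDeriv (b i) u))) x +
      4 * ∑ k, ⟪b k, K (b i)⟫_ℝ * dirDeriv a (dirDeriv (b k) (dirDeriv (b i) u)) x +
      2 * ∑ k, ⟪b k, K (b i)⟫_ℝ ^ 2 * (lam k - lam i)) := by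
  obtain ⟨r, hr⟩ := exists_orthonormalBasis_curve b K hK
  have hU := fun k l => hasJet_line hΩ ((hu.dirDeriv hΩ (b l)).dirDeriv hΩ (b k)) hx a
  have hJ := HasJet.sum Finset.univ fun i _ => HasJet.const_mul (c i)
    (HasJet.sum Finset.univ fun k _ => HasJet.sum Finset.univ fun l _ =>
      ((hr i k).mul (hr i l)).mul (hU k l))
  have hexp : ∀ᶠ t in 𝓝 (0 : ℝ), ∑ i, c i * ∑ k, ∑ l, ⟪b k, r t i⟫_ℝ * ⟪b l, r t i⟫_ℝ *
      dirDeriv (b k) (dirDeriv (b l) u) (x + t • a) =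
        ∑ i, c i * dirDeriv (r t i) (dirDeriv (r t i) u) (x + t • a) := by
    filter_upwards [eventually_line_mem hΩ hx a] with t ht
    refine Finset.sum_congr rfl fun i _ => ?_
    congr 1
    simp only [dirDeriv_dirDeriv hΩ hu ht]
    exact (secondDeriv_expand b _ _ _).symm
  have hmin := hJ.nonneg_of_isLocalMin (by
    filter_upwards [eventually_line_mem hΩ hx a, hexp] with t ht h1
    refine le_trans (le_of_eq hJ.1) ?_
    rw [h1]
    refine le_trans (le_of_eq ?_) (hle _ ht (r t))
    simp [hdiag, heq])
  have hsymm : ∀ k l, dirDeriv a (dirDeriv (b k) (dirDeriv (b l) u)) x =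
      dirDeriv a (dirDeriv (b l) (dirDeriv (b k) u)) x := fun k l =>
    dirDeriv_congr hΩ (fun y hy => dirDeriv_comm hΩ hu hy _ _) hx a
  refine hmin.trans (le_of_eq (Finset.sum_congr rfl fun i _ => ?_))
  congr 1
  -- Skewness gives ⟨bᵢ, K²bᵢ⟩ = -|K bᵢ|². This second-order motion of the frame is what turns `lam
  -- k` into the difference `lam k - lam i`.
  have hKK : ⟪b i, K (K (b i))⟫_ℝ = -∑ k, ⟪b k, K (b i)⟫_ℝ ^ 2 := by
    rw [inner_skew hK, real_inner_self_eq_norm_sq, ← b.sum_sq_norm_inner_right]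
    simp
  have hf : ∀ k, ⟪b k, K (b i)⟫_ℝ ^ 2 * (lam k - lam i) =
      ⟪b k, K (b i)⟫_ℝ * ⟪b k, K (b i)⟫_ℝ * lam k - lam i * ⟪b k, K (b i)⟫_ℝ ^ 2 :=
    fun k => by ring
  simp only [hf, Finset.sum_sub_distrib, ← Finset.mul_sum]
  rw [← neg_eq_iff_eq_neg] at hKK
  rw [← hKK]
  simp only [hdiag, Finset.sum_add_distrib, add_mul, mul_add, mul_ite, ite_mul, mul_one, mul_zero,
    zero_mul, one_mul, Finset.sum_ite_eq, Finset.sum_ite_eq', Finset.mem_univ, if_true,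
    ← Finset.mul_sum, ← ite_and]
  have hA : ∀ P : Fin n → Fin n → ℝ, ∑ k, ∑ l, (if k = i then P k l else 0) = ∑ l, P i l := by
    intro P
    rw [Finset.sum_comm]
    simp
  have hB : ∀ P : Fin n → Fin n → ℝ,
      ∑ k, ∑ l, (if l = i ∧ k = i then P k l else 0) = P i i := by
    intro P
    simp [ite_and]
  rw [hA, hB]
  simp only [fun l => hsymm i l, ← Finset.mul_sum, mul_assoc]
  ring

/-- The rotation inequality for rotations of the plane spanned by `b j` and `∑ kᵢ bᵢ`. -/
lemma plane_rotation_inequality (hΩ : IsOpen Ω) (hu : ContDiffOn ℝ ∞ u Ω) (hx : x ∈ Ω)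
    (b : OrthonormalBasis (Fin n) ℝ (EuclideanSpace ℝ (Fin n))) {lam c : Fin n → ℝ}
    (hdiag : ∀ i j, dirDeriv (b i) (dirDeriv (b j) u) x = if i = j then lam i else 0)
    (hle : ∀ y ∈ Ω, ∀ r : OrthonormalBasis (Fin n) ℝ (EuclideanSpace ℝ (Fin n)),
      1 ≤ ∑ i, c i * dirDeriv (r i) (dirDeriv (r i) u) y)
    (heq : ∑ i, c i * lam i = 1) (k : Fin n → ℝ) (j : Fin n)
    (a : EuclideanSpace ℝ (Fin n)) :
    0 ≤ ∑ i, c i * dirDeriv a (dirDeriv a (dirDeriv (b i) (dirDeriv (b i) u))) x +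
      4 * ∑ i, (c i - c j) * k i * dirDeriv a (dirDeriv (b j) (dirDeriv (b i) u)) x +
      2 * ∑ i, (c i - c j) * (lam j - lam i) * k i ^ 2 := by
  set z : EuclideanSpace ℝ (Fin n) := ∑ i, k i • b i with hz
  -- This is the rank-two skew operator with K bᵢ = kᵢ bⱼ for i ≠ j and K bⱼ = kⱼ bⱼ - z. Since bᵢ
  -- and bⱼ turn in opposite senses, the weights enter only as `c i - c j`.
  set K : EuclideanSpace ℝ (Fin n) →L[ℝ] EuclideanSpace ℝ (Fin n) :=
    (innerSL ℝ z).smulRight (b j) - (innerSL ℝ (b j)).smulRight z with hKdef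
  have hKapply : ∀ y, K y = ⟪z, y⟫_ℝ • b j - ⟪b j, y⟫_ℝ • z := fun y => by simp [K]
  have hK : K ∈ skewAdjoint (EuclideanSpace ℝ (Fin n) →L[ℝ] EuclideanSpace ℝ (Fin n)) := by
    rw [skewAdjoint.mem_iff]
    refine ContinuousLinearMap.ext fun y => ext_inner_left ℝ fun w => ?_
    rw [ContinuousLinearMap.star_eq_adjoint, ContinuousLinearMap.adjoint_inner_right,
      neg_apply, inner_neg_right, hKapply, hKapply]
    simp only [inner_sub_left, inner_sub_right, inner_smul_left, inner_smul_right]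
    rw [real_inner_comm w (b j), real_inner_comm w z]
    simp
    ring
  have hzi : ∀ i, ⟪z, b i⟫_ℝ = k i := by
    intro i
    rw [hz, sum_inner]
    simp [inner_smul_left, orthonormal_iff_ite.1 b.orthonormal]
  have hM : ∀ l i, ⟪b l, K (b i)⟫_ℝ = (if l = j then k i else 0) - if i = j then k l else 0 := by
    intro l i
    have h1 : ⟪b l, z⟫_ℝ = k l := by rw [real_inner_comm, hzi]
    rw [hKapply, inner_sub_right, inner_smul_right, inner_smul_right, hzi, h1,
      orthonormal_iff_ite.1 b.orthonormal, orthonormal_iff_ite.1 b.orthonormal]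
    simp [eq_comm]
  have hsymm : ∀ k l, dirDeriv a (dirDeriv (b k) (dirDeriv (b l) u)) x =
      dirDeriv a (dirDeriv (b l) (dirDeriv (b k) u)) x := fun k l =>
    dirDeriv_congr hΩ (fun y hy => dirDeriv_comm hΩ hu hy _ _) hx a
  have h := rotation_inequality hΩ hu hx b hdiag hle heq hK a
  refine h.trans (le_of_eq ?_)
  have hM2 : ∀ l i, ((if l = j then k i else 0) - if i = j then k l else 0) ^ 2 *
      (lam l - lam i) = (if l = j then k i ^ 2 * (lam j - lam i) else 0) +
        if i = j then k l ^ 2 * (lam l - lam j) else 0 := by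
    intro l i
    by_cases h1 : l = j <;> by_cases h2 : i = j <;> simp [h1, h2]
  have hV : ∀ i, ∑ l, ⟪b l, K (b i)⟫_ℝ * dirDeriv a (dirDeriv (b l) (dirDeriv (b i) u)) x =
      k i * dirDeriv a (dirDeriv (b j) (dirDeriv (b i) u)) x -
        if i = j then ∑ l, k l * dirDeriv a (dirDeriv (b j) (dirDeriv (b l) u)) x else 0 := by
    intro i
    simp only [hM, sub_mul, ite_mul, zero_mul, Finset.sum_sub_distrib, Finset.sum_ite_eq',
      Finset.mem_univ, if_true]
    by_cases h1 : i = j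
    · simp only [h1, if_true, hsymm j]
    · simp [h1]
  have hW : ∀ i, ∑ l, ⟪b l, K (b i)⟫_ℝ ^ 2 * (lam l - lam i) = k i ^ 2 * (lam j - lam i) -
        if i = j then ∑ l, k l ^ 2 * (lam j - lam l) else 0 := by
    intro i
    simp only [hM, hM2, Finset.sum_add_distrib, Finset.sum_ite_eq', Finset.mem_univ, if_true]
    by_cases h1 : i = j
    · simp only [h1, if_true, ← Finset.sum_neg_distrib, sub_eq_add_neg]
      congr 1
      exact Finset.sum_congr rfl fun l _ => by ring
    · simp [h1]
  have hC : ∀ P : ℝ, ∑ i, c i * (if i = j then P else 0) = c j * P := by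
    intro P
    simp
  simp only [hV, hW]
  simp only [mul_add, mul_sub, Finset.sum_add_distrib, Finset.sum_sub_distrib,
    mul_left_comm (c _) (4 : ℝ), mul_left_comm (c _) (2 : ℝ), ← Finset.mul_sum, hC]
  simp only [Finset.mul_sum, ← Finset.sum_sub_distrib, ← Finset.sum_add_distrib]
  exact Finset.sum_congr rfl fun i _ => by ring

end Rotation

/-! ### Linearizations of the equation, and the sign and bound of the solution. -/

section Linearization

open Filter Topology
open scoped InnerProductSpace

variable {n : ℕ}

/-- An eigenbasis `b` of `D²u(x)` with eigenvalues `lam`, together with the coefficients `c` of an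
operator `∑ cᵢ ∂ᵢᵢ` that dominates the constant `1` on `D²u` throughout `Ω` and touches it at `x`,
and with the quantitative bounds on these data. -/
structure IsLinearization (Ω : Set (EuclideanSpace ℝ (Fin n))) (u : EuclideanSpace ℝ (Fin n) → ℝ)
    (N₁ N₂ D₁ D₂ τ γ : ℝ) (x : EuclideanSpace ℝ (Fin n))
    (b : OrthonormalBasis (Fin n) ℝ (EuclideanSpace ℝ (Fin n))) (lam c : Fin n → ℝ) : Prop where
  diag : ∀ i j, dirDeriv (b i) (dirDeriv (b j) u) x = if i = j then lam i else 0
  pos : ∀ i, 0 < c i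
  sum_eq : ∑ i, c i * lam i = 1
  le_sum : ∀ y ∈ Ω, ∀ r : OrthonormalBasis (Fin n) ℝ (EuclideanSpace ℝ (Fin n)),
    1 ≤ ∑ i, c i * dirDeriv (r i) (dirDeriv (r i) u) y
  le_trace : τ ≤ ∑ i, c i
  mul_le : ∀ i, D₁ < lam i → c i * lam i ≤ D₂
  lower : ∀ M, 0 < M → ∑ i, c i ≤ M → ∀ i, 1 / (N₁ * M ^ N₂) ≤ c i
  abs_le : ∀ Λ, (∀ i, lam i ≤ Λ) → ∀ i, |lam i| ≤ γ * Λ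

/-- A smooth function vanishing on the boundary of `Ω`, with a linearization at every point;
`Ω` lies in the ball of radius `R` around `p`. -/
structure IsLinearizable (Ω : Set (EuclideanSpace ℝ (Fin n))) (u : EuclideanSpace ℝ (Fin n) → ℝ)
    (N₁ N₂ D₁ D₂ τ γ R : ℝ) (p : EuclideanSpace ℝ (Fin n)) : Prop where
  isOpen : IsOpen Ω
  smooth : ContDiffOn ℝ ∞ u Ω
  cont : ContinuousOn u (closure Ω)
  boundary : ∀ x ∈ frontier Ω, u x = 0
  exists_linearization : ∀ x ∈ Ω, ∃ b lam c, IsLinearization Ω u N₁ N₂ D₁ D₂ τ γ x b lam c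
  norm_sub_le : ∀ x ∈ closure Ω, ‖x - p‖ ≤ R

section Jets

variable {E : Type*} [NormedAddCommGroup E] [InnerProductSpace ℝ E]

lemma HasJet.id : HasJet (fun t => t) 0 1 0 :=
  ⟨rfl, fun _ => 1, Eventually.of_forall fun t => hasDerivAt_id t, rfl, hasDerivAt_const 0 1⟩

lemma hasJet_norm_sub_sq (x p a : E) :
    HasJet (fun t => ‖x + t • a - p‖ ^ 2) (‖x - p‖ ^ 2) (2 * ⟪x - p, a⟫_ℝ) (2 * ‖a‖ ^ 2) := by
  have h : (fun t : ℝ => ‖x + t • a - p‖ ^ 2) =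
      fun t => ‖x - p‖ ^ 2 + (2 * ⟪x - p, a⟫_ℝ * t + ‖a‖ ^ 2 * (t * t)) := by
    ext t
    rw [show x + t • a - p = (x - p) + t • a by abel, norm_add_sq_real, norm_smul,
      inner_smul_right, mul_pow, Real.norm_eq_abs, sq_abs]
    ring
  rw [h]
  refine ((HasJet.const _).add ((HasJet.id.const_mul _).add
    ((HasJet.id.mul HasJet.id).const_mul _))).congr ?_ ?_ ?_ <;> ring

/-- First and second order conditions along a line at a local maximum of `Wᵃ P e^G`. -/
lemma log_maximum_test {W P G : E → ℝ} {x v : E} {s w w₁ w₂ p p₁ p₂ g g₁ g₂ : ℝ}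
    (hW : HasJet (fun t => W (x + t • v)) w w₁ w₂) (hP : HasJet (fun t => P (x + t • v)) p p₁ p₂)
    (hG : HasJet (fun t => G (x + t • v)) g g₁ g₂) (hw : 0 < w) (hp : 0 < p)
    (hmax : ∀ᶠ y in 𝓝 x, W y ^ s * P y * Real.exp (G y) ≤ W x ^ s * P x * Real.exp (G x)) :
    s * (w₁ / w) + p₁ / p + g₁ = 0 ∧
      s * (w₂ / w - w₁ ^ 2 / w ^ 2) + (p₂ / p - p₁ ^ 2 / p ^ 2) + g₂ ≤ 0 := by
  have hJ := (((hW.log hw).const_mul s).add (hP.log hp)).add hG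
  have hpos : ∀ {Q : E → ℝ} {q q₁ q₂ : ℝ}, HasJet (fun t => Q (x + t • v)) q q₁ q₂ → 0 < q →
      ∀ᶠ t : ℝ in 𝓝 0, 0 < Q (x + t • v) := by
    intro Q q q₁ q₂ hQ hq
    obtain ⟨rfl, _, h1, _⟩ := hQ
    exact h1.self_of_nhds.continuousAt.eventually_const_lt hq
  have hlocal : IsLocalMax
      (fun t : ℝ => s * Real.log (W (x + t • v)) + Real.log (P (x + t • v)) + G (x + t • v)) 0 := by
    have hline : Tendsto (fun t : ℝ => x + t • v) (𝓝 0) (𝓝 x) := by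
      have : Continuous fun t : ℝ => x + t • v := by fun_prop
      simpa using this.tendsto 0
    have hexp : ∀ t : ℝ, 0 < W (x + t • v) → 0 < P (x + t • v) →
        Real.exp (s * Real.log (W (x + t • v)) + Real.log (P (x + t • v)) + G (x + t • v)) =
          W (x + t • v) ^ s * P (x + t • v) * Real.exp (G (x + t • v)) := by
      intro t h1 h2
      rw [Real.exp_add, Real.exp_add, Real.exp_log h2, Real.rpow_def_of_pos h1, mul_comm s]
    filter_upwards [hline.eventually hmax, hpos hW hw, hpos hP hp] with t h1 h2 h3
    rw [← Real.exp_le_exp, hexp t h2 h3, hexp 0 (hpos hW hw).self_of_nhds (hpos hP hp).self_of_nhds]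
    simpa using h1
  exact ⟨hJ.eq_zero_of_isLocalMax hlocal, hJ.nonpos_of_isLocalMax hlocal⟩

end Jets

section Gradient

variable {Ω : Set (EuclideanSpace ℝ (Fin n))} {u : EuclideanSpace ℝ (Fin n) → ℝ}
  {x : EuclideanSpace ℝ (Fin n)}

lemma norm_gradient_sq (b : OrthonormalBasis (Fin n) ℝ (EuclideanSpace ℝ (Fin n)))
    (u : EuclideanSpace ℝ (Fin n) → ℝ) (x : EuclideanSpace ℝ (Fin n)) :
    ‖∇ u x‖ ^ 2 = ∑ k, dirDeriv (b k) u x * dirDeriv (b k) u x := by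
  rw [← b.sum_sq_norm_inner_left]
  refine Finset.sum_congr rfl fun k _ => ?_
  rw [dirDeriv, gradient, InnerProductSpace.toDual_symm_apply, Real.norm_eq_abs, sq_abs, sq]

/-- The third derivatives are ordered with the gradient direction outermost, so that summing over
`i` with weights `c i` makes them vanish by the differentiated equation (`sum_gradient_term`). -/
lemma hasJet_norm_gradient_sq (hΩ : IsOpen Ω) (hu : ContDiffOn ℝ ∞ u Ω) (hx : x ∈ Ω)
    {b : OrthonormalBasis (Fin n) ℝ (EuclideanSpace ℝ (Fin n))} {lam : Fin n → ℝ}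
    (hdiag : ∀ i j, dirDeriv (b i) (dirDeriv (b j) u) x = if i = j then lam i else 0) (i : Fin n) :
    HasJet (fun t => ‖∇ u (x + t • b i)‖ ^ 2) (‖∇ u x‖ ^ 2) (2 * (lam i * dirDeriv (b i) u x))
      (2 * (lam i ^ 2 + ∑ k, dirDeriv (b k) u x *
        dirDeriv (b k) (dirDeriv (b i) (dirDeriv (b i) u)) x)) := by
  simp only [norm_gradient_sq b]
  have h1 := fun k => hasJet_line hΩ (hu.dirDeriv hΩ (b k)) hx (b i)
  have h2 := HasJet.sum Finset.univ fun k _ => (h1 k).mul (h1 k)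
  have h3 : ∀ k, dirDeriv (b i) (dirDeriv (b i) (dirDeriv (b k) u)) x =
      dirDeriv (b k) (dirDeriv (b i) (dirDeriv (b i) u)) x := by
    intro k
    rw [dirDeriv_congr hΩ (fun y hy => dirDeriv_comm hΩ hu hy (b i) (b k)) hx (b i),
      dirDeriv_comm hΩ (hu.dirDeriv hΩ _) hx]
  refine h2.congr rfl ?_ ?_
  · simp only [hdiag, ite_mul, mul_ite, zero_mul, mul_zero, Finset.sum_add_distrib,
      Finset.sum_ite_eq, Finset.mem_univ, if_true]
    ring
  · simp only [hdiag, h3, ite_mul, mul_ite, zero_mul, mul_zero, Finset.sum_add_distrib,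
      Finset.sum_ite_eq, Finset.mem_univ, if_true]
    rw [Finset.sum_congr rfl fun k _ => mul_comm (dirDeriv (b k) _ x) (dirDeriv (b k) u x)]
    ring

end Gradient

namespace IsLinearization

variable {Ω : Set (EuclideanSpace ℝ (Fin n))} {u : EuclideanSpace ℝ (Fin n) → ℝ}
  {N₁ N₂ D₁ D₂ τ γ : ℝ} {x : EuclideanSpace ℝ (Fin n)}
  {b : OrthonormalBasis (Fin n) ℝ (EuclideanSpace ℝ (Fin n))} {lam c : Fin n → ℝ}

lemma exists_pos (h : IsLinearization Ω u N₁ N₂ D₁ D₂ τ γ x b lam c) : ∃ i, 0 < lam i := by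
  by_contra! hc
  have h1 : ∑ i, c i * lam i ≤ 0 :=
    Finset.sum_nonpos fun i _ => mul_nonpos_of_nonneg_of_nonpos (h.pos i).le (hc i)
  linarith [h.sum_eq]

lemma sum_third (h : IsLinearization Ω u N₁ N₂ D₁ D₂ τ γ x b lam c) (hΩ : IsOpen Ω)
    (hu : ContDiffOn ℝ ∞ u Ω) (hx : x ∈ Ω) (a : EuclideanSpace ℝ (Fin n)) :
    ∑ i, c i * dirDeriv a (dirDeriv (b i) (dirDeriv (b i) u)) x = 0 :=
  sum_third_deriv_eq_zero hΩ hu hx b (fun y hy => h.le_sum y hy b)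
    (by simpa [h.diag] using h.sum_eq) a

lemma sum_gradient_term (h : IsLinearization Ω u N₁ N₂ D₁ D₂ τ γ x b lam c) (hΩ : IsOpen Ω)
    (hu : ContDiffOn ℝ ∞ u Ω) (hx : x ∈ Ω) :
    ∑ i, c i * ∑ k, dirDeriv (b k) u x *
      dirDeriv (b k) (dirDeriv (b i) (dirDeriv (b i) u)) x = 0 := by
  simp only [Finset.mul_sum]
  rw [Finset.sum_comm]
  refine Finset.sum_eq_zero fun k _ => ?_
  rw [← mul_zero (dirDeriv (b k) u x), ← h.sum_third hΩ hu hx (b k), Finset.mul_sum]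
  exact Finset.sum_congr rfl fun i _ => by ring

end IsLinearization

namespace IsLinearizable

variable {Ω : Set (EuclideanSpace ℝ (Fin n))} {u : EuclideanSpace ℝ (Fin n) → ℝ}
  {N₁ N₂ D₁ D₂ τ γ R : ℝ} {x p : EuclideanSpace ℝ (Fin n)}

lemma isCompact_closure (h : IsLinearizable Ω u N₁ N₂ D₁ D₂ τ γ R p) : IsCompact (closure Ω) :=
  Metric.isCompact_of_isClosed_isBounded isClosed_closure
    ((Metric.isBounded_closedBall (x := p) (r := R)).subset fun y hy => by
      simpa [dist_eq_norm] using h.norm_sub_le y hy)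

lemma mem_or_eq_zero (h : IsLinearizable Ω u N₁ N₂ D₁ D₂ τ γ R p) (hx : x ∈ closure Ω) :
    x ∈ Ω ∨ u x = 0 := by
  by_cases hxΩ : x ∈ Ω
  · exact Or.inl hxΩ
  · refine Or.inr (h.boundary x ?_)
    rw [h.isOpen.frontier_eq]
    exact ⟨hx, hxΩ⟩

/-- At an interior maximum every eigenvalue would be nonpositive, against `exists_pos`. If u(x) ≥ 0
and the maximum over the closure is attained outside `Ω`, where u = 0, then x itself is an interior
maximum. -/
lemma neg (h : IsLinearizable Ω u N₁ N₂ D₁ D₂ τ γ R p) (hx : x ∈ Ω) : u x < 0 := by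
  have hno : ∀ z ∈ Ω, ¬ ∀ y ∈ Ω, u y ≤ u z := by
    intro z hz hmax
    obtain ⟨b, lam, c, hl⟩ := h.exists_linearization z hz
    obtain ⟨i, hi⟩ := hl.exists_pos
    have h1 := (hasJet_line h.isOpen h.smooth hz (b i)).nonpos_of_isLocalMax (by
      filter_upwards [eventually_line_mem h.isOpen hz (b i)] with t ht
      simpa using hmax _ ht)
    rw [hl.diag, if_pos rfl] at h1
    linarith
  by_contra! hpos
  obtain ⟨z, hz, hmax⟩ := h.isCompact_closure.exists_isMaxOn ⟨x, subset_closure hx⟩ h.cont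
  rcases h.mem_or_eq_zero hz with hzΩ | hz0
  · exact hno z hzΩ fun y hy => hmax (subset_closure hy)
  · exact hno x hx fun y hy => le_trans (hmax (subset_closure hy)) (hz0.le.trans hpos)

/-- Compare with the paraboloid |y - p|²/τ. At an interior minimum of the difference all eigenvalues
are at least 2/τ, and the trace bound gives 1 = ∑ cᵢλᵢ ≥ 2. -/
lemma neg_le (h : IsLinearizable Ω u N₁ N₂ D₁ D₂ τ γ R p) (hτ : 0 < τ) (hx : x ∈ Ω) :
    -u x ≤ R ^ 2 / τ := by
  have hcont : ContinuousOn (fun y => u y + -(1 / τ) * ‖y - p‖ ^ 2) (closure Ω) := by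
    have : Continuous fun y : EuclideanSpace ℝ (Fin n) => -(1 / τ) * ‖y - p‖ ^ 2 := by fun_prop
    exact h.cont.add this.continuousOn
  obtain ⟨z, hz, hmin⟩ := h.isCompact_closure.exists_isMinOn ⟨x, subset_closure hx⟩ hcont
  have hzR : ‖z - p‖ ^ 2 ≤ R ^ 2 := by
    have := h.norm_sub_le z hz
    gcongr
  rcases h.mem_or_eq_zero hz with hzΩ | hz0
  · exfalso
    obtain ⟨b, lam, c, hl⟩ := h.exists_linearization z hzΩ
    have h1 : ∀ i, 2 / τ ≤ lam i := by
      intro i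
      have hJ := (hasJet_line h.isOpen h.smooth hzΩ (b i)).add
        ((hasJet_norm_sub_sq z p (b i)).const_mul (-(1 / τ)))
      have h2 := hJ.nonneg_of_isLocalMin (by
        filter_upwards [eventually_line_mem h.isOpen hzΩ (b i)] with t ht
        simpa using hmin (subset_closure ht))
      rw [hl.diag, if_pos rfl, b.norm_eq_one] at h2
      have : 2 / τ = 1 / τ * 2 := by ring
      linarith
    have h2 : ∑ i, c i * (2 / τ) ≤ ∑ i, c i * lam i :=
      Finset.sum_le_sum fun i _ => mul_le_mul_of_nonneg_left (h1 i) (hl.pos i).le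
    rw [hl.sum_eq, ← Finset.sum_mul] at h2
    have h3 : τ * (2 / τ) ≤ (∑ i, c i) * (2 / τ) :=
      mul_le_mul_of_nonneg_right hl.le_trace (by positivity)
    have h4 : τ * (2 / τ) = 2 := by field_simp
    linarith
  · have h1 := hmin (subset_closure hx)
    simp only [Set.mem_ofPred_eq, hz0] at h1
    have h2 : 0 ≤ 1 / τ * ‖x - p‖ ^ 2 := by positivity
    have h3 : 1 / τ * ‖z - p‖ ^ 2 ≤ 1 / τ * R ^ 2 := by gcongr
    have h4 : R ^ 2 / τ = 1 / τ * R ^ 2 := by ring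
    linarith

/-- Positivity of `ε` keeps the set away from the boundary, where u = 0. Auxiliary functions that
are continuous only inside `Ω` therefore attain their maximum on it. -/
lemma isCompact_superlevel (h : IsLinearizable Ω u N₁ N₂ D₁ D₂ τ γ R p) {ε : ℝ} (hε : 0 < ε) :
    IsCompact {y | y ∈ Ω ∧ ε ≤ -u y} := by
  have h1 : {y | y ∈ Ω ∧ ε ≤ -u y} = closure Ω ∩ (fun y => -u y) ⁻¹' Set.Ici ε := by
    ext y
    refine ⟨fun hy => ⟨subset_closure hy.1, hy.2⟩, fun hy => ⟨?_, hy.2⟩⟩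
    refine (h.mem_or_eq_zero hy.1).resolve_right fun h0 => ?_
    have : ε ≤ -u y := hy.2
    linarith
  rw [h1]
  exact h.isCompact_closure.of_isClosed_subset
    (h.cont.neg.preimage_isClosed_of_isClosed isClosed_closure isClosed_Ici) Set.inter_subset_left

lemma superlevel_mem_nhds (h : IsLinearizable Ω u N₁ N₂ D₁ D₂ τ γ R p) {ε : ℝ} (hx : x ∈ Ω)
    (hε : ε < -u x) : ∀ᶠ y in 𝓝 x, y ∈ Ω ∧ ε ≤ -u y := by
  have h1 : ContinuousAt (fun y => -u y) x :=
    (h.smooth.continuousOn.continuousAt (h.isOpen.mem_nhds hx)).neg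
  filter_upwards [h.isOpen.mem_nhds hx, h1.eventually_const_lt hε] with y hy1 hy2
  exact ⟨hy1, hy2.le⟩

end IsLinearizable

end Linearization

/-! ### Interior gradient estimate. -/

section GradientEstimate

open Filter Topology
open scoped InnerProductSpace

variable {n : ℕ}

/-- The bound for `wˢ |Du|²` at a maximum point of the auxiliary function. -/
noncomputable def gradientBound (n : ℕ) (s R C₀ N₁ N₂ D₁ D₂ : ℝ) : ℝ :=
  C₀ ^ s * (4 * C₀ * |D₁|) + C₀ ^ s * (n * (C₀ / R) ^ 2) +
    4 * |D₂| * N₁ * (56 * R ^ 2 * (s + (1 + 2 * s) * (4 * |D₂|))) ^ N₂ * C₀ ^ (s + 1 - N₂)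

/-- In a direction in which the gradient is not small, the first-order condition makes the
eigenvalue large. -/
lemma eigenvalue_large {lam v y w q s R A : ℝ} (hw : 0 < w) (hq : 0 < q) (hA : 0 < A)
    (hR : 0 < R) (hs : 1 ≤ s) (hy : |y| ≤ R)
    (h1 : s * (-v / w) + 2 * (lam * v) / q + A * (2 * y) = 0)
    (hv : 4 * A * R * w ≤ s * |v|) : s * q / (4 * w) ≤ lam := by
  have hv0 : 0 < |v| := by
    have : 0 < 4 * A * R * w := by positivity
    by_contra! hc
    nlinarith
  have h2 : 2 * lam * v ^ 2 / q = s * v ^ 2 / w - 2 * A * y * v := by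
    have : v * (s * (-v / w) + 2 * (lam * v) / q + A * (2 * y)) = 0 := by rw [h1, mul_zero]
    have e : v * (s * (-v / w) + 2 * (lam * v) / q + A * (2 * y)) =
      2 * lam * v ^ 2 / q - (s * v ^ 2 / w - 2 * A * y * v) := by ring
    linarith
  -- By `hv` the paraboloid term takes away at most half of the cutoff term s v²/w.
  have h3 : 2 * A * y * v ≤ s * v ^ 2 / (2 * w) := by
    have h4 : y * v ≤ R * |v| := by
      calc y * v ≤ |y * v| := le_abs_self _
        _ = |y| * |v| := abs_mul _ _
        _ ≤ R * |v| := by gcongr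
    rw [le_div_iff₀ (by positivity)]
    calc 2 * A * y * v * (2 * w) = (4 * A * w) * (y * v) := by ring
      _ ≤ (4 * A * w) * (R * |v|) := by gcongr
      _ = (4 * A * R * w) * |v| := by ring
      _ ≤ (s * |v|) * |v| := by gcongr
      _ = s * v ^ 2 := by rw [mul_assoc, abs_mul_abs_self, sq]
  have h5 : s * v ^ 2 / (2 * w) ≤ 2 * lam * v ^ 2 / q := by
    have : s * v ^ 2 / w = 2 * (s * v ^ 2 / (2 * w)) := by field_simp
    linarith
  have hv2 : 0 < v ^ 2 := by rw [← sq_abs]; positivity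
  rw [div_le_div_iff₀ (by positivity) hq] at h5
  rw [div_le_iff₀ (by positivity)]
  have h6 : (s * q) * v ^ 2 ≤ (lam * (4 * w)) * v ^ 2 := by linarith
  exact le_of_mul_le_mul_right h6 hv2

/-- Half of the left side of `h2` absorbs the small components of the gradient. For large components
condition D bounds cᵢ s q/(4w) by |D₂|, and their contributions sum to a multiple of 1/w because ∑
vᵢ² = q. -/
lemma trace_bound_of_first_order {c lam v y : Fin n → ℝ} {w q s R A D₁ D₂ : ℝ}
    (hc : ∀ i, 0 < c i) (hw : 0 < w) (hqv : q = ∑ i, v i ^ 2) (hq : 0 < q) (hs : 1 ≤ s)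
    (hR : 0 < R) (hA : 0 < A) (hAR : 56 * (A * R ^ 2) = 1) (hy : ∀ i, |y i| ≤ R)
    (hD : ∀ i, D₁ < lam i → c i * lam i ≤ D₂)
    (h1 : ∀ i, s * (-v i / w) + 2 * (lam i * v i) / q + A * (2 * y i) = 0)
    (h2 : 2 * A * ∑ i, c i ≤ s / w + ∑ i, c i * (s * (v i ^ 2 / w ^ 2)) +
      ∑ i, c i * (2 * (lam i * v i) / q) ^ 2)
    (hcase : D₁ < s * q / (4 * w)) :
    A * ∑ i, c i ≤ (s + (1 + 2 * s) * (4 * |D₂|)) / w := by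
  have key : ∀ i, c i * (s * (v i ^ 2 / w ^ 2)) + c i * (2 * (lam i * v i) / q) ^ 2 ≤
      A * c i + (1 + 2 * s) * (4 * |D₂|) / (w * q) * v i ^ 2 := by
    intro i
    have e1 : 2 * (lam i * v i) / q = s * (v i / w) - A * (2 * y i) := by
      have := h1 i
      have e : s * (-v i / w) = -(s * (v i / w)) := by ring
      linarith
    have hy2 : y i ^ 2 ≤ R ^ 2 := sq_le_sq' (by linarith [neg_abs_le (y i), hy i])
      (by linarith [le_abs_self (y i), hy i])
    have e2 : (2 * (lam i * v i) / q) ^ 2 ≤ 2 * s ^ 2 * (v i / w) ^ 2 + 8 * A ^ 2 * R ^ 2 := by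
      rw [e1]
      nlinarith [sq_nonneg (s * (v i / w) + A * (2 * y i)),
        mul_le_mul_of_nonneg_left hy2 (sq_nonneg A)]
    -- The constant 56 is 48 + 8: for a small component the terms in (vᵢ/w)² cost at most 48 A²R²,
    -- and the paraboloid part of the squared first-order condition costs 8 A²R².
    have e3 : A = 56 * (A ^ 2 * R ^ 2) := by
      have : A * (56 * (A * R ^ 2)) = A := by rw [hAR, mul_one]
      linarith
    have e4 : c i * (s * (v i ^ 2 / w ^ 2)) + c i * (2 * (lam i * v i) / q) ^ 2 ≤
        c i * ((s + 2 * s ^ 2) * (v i / w) ^ 2) + c i * (8 * A ^ 2 * R ^ 2) := by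
      rw [← mul_add, ← mul_add]
      refine mul_le_mul_of_nonneg_left ?_ (hc i).le
      rw [← div_pow]
      linarith
    have hnn : 0 ≤ (1 + 2 * s) * (4 * |D₂|) / (w * q) * v i ^ 2 := by positivity
    by_cases hi : 4 * A * R * w ≤ s * |v i|
    · have h3 := eigenvalue_large hw hq hA hR hs (hy i) (h1 i) hi
      have h4 := hD i (hcase.trans_le h3)
      have h5 : c i * (s * q / (4 * w)) ≤ |D₂| :=
        (mul_le_mul_of_nonneg_left h3 (hc i).le).trans (h4.trans (le_abs_self _))
      have h6 : c i * ((s + 2 * s ^ 2) * (v i / w) ^ 2) =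
          (c i * (s * q / (4 * w))) * ((1 + 2 * s) * 4 / (w * q) * v i ^ 2) := by
        field_simp
      have h7 : (c i * (s * q / (4 * w))) * ((1 + 2 * s) * 4 / (w * q) * v i ^ 2) ≤
          |D₂| * ((1 + 2 * s) * 4 / (w * q) * v i ^ 2) :=
        mul_le_mul_of_nonneg_right h5 (by positivity)
      have h8 : |D₂| * ((1 + 2 * s) * 4 / (w * q) * v i ^ 2) =
          (1 + 2 * s) * (4 * |D₂|) / (w * q) * v i ^ 2 := by ring
      have h9 : c i * (8 * A ^ 2 * R ^ 2) ≤ A * c i := by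
        have : 0 ≤ c i * (A ^ 2 * R ^ 2) := mul_nonneg (hc i).le (by positivity)
        have e : A * c i = 56 * (c i * (A ^ 2 * R ^ 2)) := by
          nth_rewrite 1 [e3]; ring
        linarith
      linarith
    · push Not at hi
      have h3 : s * (|v i| / w) ≤ 4 * A * R := by
        rw [← mul_div_assoc, div_le_iff₀ hw]; exact hi.le
      have h4 : (s * (|v i| / w)) ^ 2 ≤ (4 * A * R) ^ 2 := by gcongr
      have h5 : (s * (|v i| / w)) ^ 2 = s ^ 2 * (v i / w) ^ 2 := by
        rw [mul_pow, div_pow, div_pow, sq_abs]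
      have h6 : (s + 2 * s ^ 2) * (v i / w) ^ 2 ≤ 3 * (s ^ 2 * (v i / w) ^ 2) := by
        have : s ≤ s ^ 2 := by nlinarith
        nlinarith [sq_nonneg (v i / w)]
      have h7 : c i * ((s + 2 * s ^ 2) * (v i / w) ^ 2) ≤ c i * (48 * (A ^ 2 * R ^ 2)) := by
        refine mul_le_mul_of_nonneg_left ?_ (hc i).le
        nlinarith
      have e : A * c i = c i * (48 * (A ^ 2 * R ^ 2)) + c i * (8 * A ^ 2 * R ^ 2) := by
        nth_rewrite 1 [e3]; ring
      linarith
  have hsum := Finset.sum_le_sum fun i (_ : i ∈ Finset.univ) => key i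
  rw [Finset.sum_add_distrib, Finset.sum_add_distrib, ← Finset.mul_sum, ← Finset.mul_sum,
    ← hqv] at hsum
  have e : (1 + 2 * s) * (4 * |D₂|) / (w * q) * q = (1 + 2 * s) * (4 * |D₂|) / w := by
    field_simp
  rw [e] at hsum
  rw [add_div]
  linarith

/-- The three summands of `gradientBound` match three cases: s q/(4w) does not exceed `D₁`; all
components of the gradient are small; or some component is large. In the last case the trace bound
feeds N, which with D bounds `q`. The hypothesis `hsN` makes the remaining power of `w` nonnegative.
-/
lemma gradient_bound_of_first_order {c lam v y : Fin n → ℝ} {w q s R A C₀ N₁ N₂ D₁ D₂ : ℝ}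
    (hc : ∀ i, 0 < c i) (hw : 0 < w) (hwC : w ≤ C₀) (hqv : q = ∑ i, v i ^ 2) (hq : 0 < q)
    (hs : 1 ≤ s) (hsN : N₂ ≤ s + 1)
    (hR : 0 < R) (hA : 0 < A) (hAR : 56 * (A * R ^ 2) = 1) (hy : ∀ i, |y i| ≤ R) (hN₁ : 0 < N₁)
    (hD : ∀ i, D₁ < lam i → c i * lam i ≤ D₂)
    (hN : ∀ M, 0 < M → ∑ i, c i ≤ M → ∀ i, 1 / (N₁ * M ^ N₂) ≤ c i)
    (h1 : ∀ i, s * (-v i / w) + 2 * (lam i * v i) / q + A * (2 * y i) = 0)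
    (h2 : 2 * A * ∑ i, c i ≤ s / w + ∑ i, c i * (s * (v i ^ 2 / w ^ 2)) +
      ∑ i, c i * (2 * (lam i * v i) / q) ^ 2) :
    w ^ s * q ≤ gradientBound n s R C₀ N₁ N₂ D₁ D₂ := by
  have hC₀ : 0 < C₀ := hw.trans_le hwC
  have hws : w ^ s ≤ C₀ ^ s := Real.rpow_le_rpow hw.le hwC (by linarith)
  have hB : 0 < 56 * R ^ 2 * (s + (1 + 2 * s) * (4 * |D₂|)) := by positivity
  have t1 : 0 ≤ C₀ ^ s * (4 * C₀ * |D₁|) := by positivity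
  have t2 : 0 ≤ C₀ ^ s * (n * (C₀ / R) ^ 2) := by positivity
  have t3 : 0 ≤ 4 * |D₂| * N₁ * (56 * R ^ 2 * (s + (1 + 2 * s) * (4 * |D₂|))) ^ N₂ *
      C₀ ^ (s + 1 - N₂) := by positivity
  unfold gradientBound
  by_cases hcase : D₁ < s * q / (4 * w)
  · by_cases hall : ∀ i, s * |v i| < 4 * A * R * w
    · have h3 : ∀ i, v i ^ 2 ≤ (C₀ / R) ^ 2 := by
        intro i
        rw [← sq_abs]
        refine pow_le_pow_left₀ (abs_nonneg _) ?_ 2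
        rw [le_div_iff₀ hR]
        have h4 : |v i| ≤ s * |v i| := by nlinarith [abs_nonneg (v i)]
        have h5 : |v i| * R ≤ 4 * A * R * w * R := by
          refine mul_le_mul_of_nonneg_right (h4.trans (hall i).le) hR.le
        have h6 : 4 * A * R * w * R = 4 * (A * R ^ 2) * w := by ring
        nlinarith
      have h4 : q ≤ n * (C₀ / R) ^ 2 := by
        rw [hqv]
        refine (Finset.sum_le_sum fun i _ => h3 i).trans (le_of_eq ?_)
        simp
      have h5 : w ^ s * q ≤ C₀ ^ s * (n * (C₀ / R) ^ 2) :=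
        mul_le_mul hws h4 hq.le (by positivity)
      linarith
    · push Not at hall
      obtain ⟨i, hi⟩ := hall
      have h3 := trace_bound_of_first_order hc hw hqv hq hs hR hA hAR hy hD h1 h2 hcase
      set B := 56 * R ^ 2 * (s + (1 + 2 * s) * (4 * |D₂|)) with hBdef
      have h4 : ∑ i, c i ≤ B / w := by
        have e : B / w = 56 * R ^ 2 * ((s + (1 + 2 * s) * (4 * |D₂|)) / w) := by
          rw [hBdef]; ring
        rw [e]
        have h5 : 56 * R ^ 2 * (A * ∑ i, c i) ≤
          56 * R ^ 2 * ((s + (1 + 2 * s) * (4 * |D₂|)) / w) := by gcongr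
        have h6 : 56 * R ^ 2 * (A * ∑ i, c i) = (56 * (A * R ^ 2)) * ∑ i, c i := by ring
        rw [h6, hAR, one_mul] at h5
        exact h5
      have h5 := hN (B / w) (by positivity) h4 i
      have h6 := eigenvalue_large hw hq hA hR hs (hy i) (h1 i) hi
      have h7 := hD i (hcase.trans_le h6)
      have h8 : 1 / (N₁ * (B / w) ^ N₂) * (s * q / (4 * w)) ≤ |D₂| :=
        (mul_le_mul h5 h6 (by positivity) (hc i).le).trans (h7.trans (le_abs_self _))
      have hBw : 0 < (B / w) ^ N₂ := by positivity
      have h9 : q ≤ 4 * |D₂| * N₁ * (B / w) ^ N₂ * w := by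
        have e : 1 / (N₁ * (B / w) ^ N₂) * (s * q / (4 * w)) =
            s * q / (4 * N₁ * (B / w) ^ N₂ * w) := by field_simp
        rw [e, div_le_iff₀ (by positivity)] at h8
        nlinarith
      have h10 : w ^ s * q ≤ 4 * |D₂| * N₁ * B ^ N₂ * w ^ (s + 1 - N₂) := by
        refine (mul_le_mul_of_nonneg_left h9 (by positivity)).trans (le_of_eq ?_)
        rw [Real.div_rpow hB.le hw.le, Real.rpow_sub hw, Real.rpow_add hw, Real.rpow_one]
        field_simp
      have h11 : w ^ (s + 1 - N₂) ≤ C₀ ^ (s + 1 - N₂) :=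
        Real.rpow_le_rpow hw.le hwC (by linarith)
      have h12 : 4 * |D₂| * N₁ * B ^ N₂ * w ^ (s + 1 - N₂) ≤
          4 * |D₂| * N₁ * B ^ N₂ * C₀ ^ (s + 1 - N₂) := by gcongr
      linarith
  · push Not at hcase
    have h3 : q ≤ 4 * C₀ * |D₁| := by
      rw [div_le_iff₀ (by positivity)] at hcase
      have h4 : D₁ * (4 * w) ≤ |D₁| * (4 * C₀) := by
        refine mul_le_mul (le_abs_self _) (by linarith) (by positivity) (abs_nonneg _)
      nlinarith
    have h5 : w ^ s * q ≤ C₀ ^ s * (4 * C₀ * |D₁|) := mul_le_mul hws h3 hq.le (by positivity)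
    linarith

variable {Ω : Set (EuclideanSpace ℝ (Fin n))} {u : EuclideanSpace ℝ (Fin n) → ℝ}
  {N₁ N₂ D₁ D₂ τ γ R : ℝ} {x p : EuclideanSpace ℝ (Fin n)}

lemma continuousOn_gradient (hΩ : IsOpen Ω) (hu : ContDiffOn ℝ ∞ u Ω) :
    ContinuousOn (fun y => ‖∇ u y‖ ^ 2) Ω := by
  have h1 : ContinuousOn (fderiv ℝ u) Ω := (hu.fderiv_of_isOpen hΩ (m := ∞) (by simp)).continuousOn
  exact ((InnerProductSpace.toDual ℝ _).symm.continuous.comp_continuousOn h1).norm.pow 2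

lemma hasJet_neg_sub (hΩ : IsOpen Ω) (hu : ContDiffOn ℝ ∞ u Ω) (hx : x ∈ Ω) (ε : ℝ)
    (a : EuclideanSpace ℝ (Fin n)) :
    HasJet (fun t => -u (x + t • a) - ε) (-u x - ε) (-dirDeriv a u x)
      (-dirDeriv a (dirDeriv a u) x) := by
  have h := ((hasJet_line hΩ hu hx a).const_mul (-1)).add (HasJet.const (-ε))
  have e : (fun t : ℝ => -u (x + t • a) - ε) = fun t => -1 * u (x + t • a) + -ε := by
    ext t; ring
  rw [e]
  exact h.congr (by ring) (by ring) (by ring)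

/-- Interior gradient bound at the maximum point of the auxiliary function. -/
lemma IsLinearizable.gradient_bound_of_max (h : IsLinearizable Ω u N₁ N₂ D₁ D₂ τ γ R p)
    (hN₁ : 0 < N₁) (hτ : 0 < τ) (hR : 0 < R) {s A ε : ℝ} (hs : 1 ≤ s) (hsN : N₂ ≤ s + 1)
    (hA : 0 < A) (hAR : 56 * (A * R ^ 2) = 1) (hε : 0 < ε) (hx : x ∈ Ω) (hw : ε < -u x)
    (hq : 0 < ‖∇ u x‖ ^ 2)
    (hmax : ∀ y ∈ Ω, ε ≤ -u y →
      (-u y - ε) ^ s * ‖∇ u y‖ ^ 2 * Real.exp (A * ‖y - p‖ ^ 2) ≤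
        (-u x - ε) ^ s * ‖∇ u x‖ ^ 2 * Real.exp (A * ‖x - p‖ ^ 2)) :
    (-u x - ε) ^ s * ‖∇ u x‖ ^ 2 ≤ gradientBound n s R (R ^ 2 / τ) N₁ N₂ D₁ D₂ := by
  obtain ⟨b, lam, c, hl⟩ := h.exists_linearization x hx
  have hw0 : 0 < -u x - ε := by linarith
  have htest := fun i => log_maximum_test (W := fun y => -u y - ε) (P := fun y => ‖∇ u y‖ ^ 2)
    (G := fun y => A * ‖y - p‖ ^ 2) (s := s)
    (hasJet_neg_sub h.isOpen h.smooth hx ε (b i))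
    (hasJet_norm_gradient_sq h.isOpen h.smooth hx hl.diag i)
    ((hasJet_norm_sub_sq x p (b i)).const_mul A) hw0 hq (by
      filter_upwards [h.superlevel_mem_nhds hx hw] with y hy using hmax y hy.1 hy.2)
  simp only [hl.diag, if_true, b.norm_eq_one, one_pow, mul_one, neg_sq] at htest
  have hy : ∀ i, |⟪x - p, b i⟫_ℝ| ≤ R := by
    intro i
    refine (abs_real_inner_le_norm _ _).trans ?_
    rw [b.norm_eq_one, mul_one]
    exact h.norm_sub_le x (subset_closure hx)
  have hC : -u x ≤ R ^ 2 / τ := h.neg_le hτ hx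
  refine gradient_bound_of_first_order (lam := lam) (v := fun i => dirDeriv (b i) u x)
    (y := fun i => ⟪x - p, b i⟫_ℝ) hl.pos hw0 (by linarith)
    (by simp only [norm_gradient_sq b, sq]) hq hs hsN hR hA hAR hy hN₁ hl.mul_le hl.lower
    (fun i => (htest i).1) ?_
  -- Weighting the second-order conditions by `c i` eliminates all third derivatives; the
  -- nonnegative term in `lam i ^ 2` is then dropped.
  have hsum := Finset.sum_le_sum fun i (_ : i ∈ Finset.univ) =>
    mul_le_mul_of_nonneg_left (htest i).2 (hl.pos i).le
  set w := -u x - ε with hwdef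
  set q := ‖∇ u x‖ ^ 2 with hqdef
  have e : ∀ i, c i * (s * (-lam i / w - dirDeriv (b i) u x ^ 2 / w ^ 2) +
      (2 * (lam i ^ 2 + ∑ k, dirDeriv (b k) u x *
        dirDeriv (b k) (dirDeriv (b i) (dirDeriv (b i) u)) x) / q -
      (2 * (lam i * dirDeriv (b i) u x)) ^ 2 / q ^ 2) + A * 2) =
      -(s / w) * (c i * lam i) - c i * (s * (dirDeriv (b i) u x ^ 2 / w ^ 2)) +
      2 / q * (c i * lam i ^ 2) + 2 / q * (c i * ∑ k, dirDeriv (b k) u x *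
        dirDeriv (b k) (dirDeriv (b i) (dirDeriv (b i) u)) x) -
      c i * (2 * (lam i * dirDeriv (b i) u x) / q) ^ 2 + 2 * A * c i := by
    intro i; rw [div_pow]; ring
  simp only [e, Finset.sum_add_distrib, Finset.sum_sub_distrib, ← Finset.mul_sum, hl.sum_eq,
    hl.sum_gradient_term h.isOpen h.smooth hx, mul_zero, Finset.sum_const_zero, mul_one] at hsum
  have hnn : 0 ≤ 2 / q * ∑ i, c i * lam i ^ 2 :=
    mul_nonneg (by positivity) (Finset.sum_nonneg fun i _ =>
      mul_nonneg (hl.pos i).le (sq_nonneg _))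
  linarith

/-- The cutoff is at half the height of x, so w = -u(x)/2 there, which costs the factor 2^s. It
vanishes on the level set -u = ε, so a maximum with positive value has -u > ε. Since A R² = 1/56,
the exponential lies between 1 and e. -/
theorem IsLinearizable.gradient_estimate (h : IsLinearizable Ω u N₁ N₂ D₁ D₂ τ γ R p)
    (hN₁ : 0 < N₁) (hτ : 0 < τ) (hR : 0 < R) {s : ℝ} (hs : 1 ≤ s) (hsN : N₂ ≤ s + 1)
    (hx : x ∈ Ω) :
    (-u x) ^ s * ‖∇ u x‖ ^ 2 ≤
      2 ^ s * (gradientBound n s R (R ^ 2 / τ) N₁ N₂ D₁ D₂ * Real.exp 1) := by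
  have hux : 0 < -u x := by linarith [h.neg hx]
  have hC₀ : 0 < R ^ 2 / τ := by positivity
  have hbound : 0 ≤ gradientBound n s R (R ^ 2 / τ) N₁ N₂ D₁ D₂ := by
    unfold gradientBound; positivity
  set A : ℝ := 1 / (56 * R ^ 2) with hAdef
  have hA : 0 < A := by positivity
  have hAR : 56 * (A * R ^ 2) = 1 := by rw [hAdef]; field_simp
  set ε : ℝ := -u x / 2 with hεdef
  have hε : 0 < ε := by positivity
  have hK := h.isCompact_superlevel hε
  set Φ : EuclideanSpace ℝ (Fin n) → ℝ := fun y =>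
    (-u y - ε) ^ s * ‖∇ u y‖ ^ 2 * Real.exp (A * ‖y - p‖ ^ 2) with hΦ
  have hΦcont : ContinuousOn Φ {y | y ∈ Ω ∧ ε ≤ -u y} := by
    have h1 : ContinuousOn (fun y => -u y - ε) Ω := h.smooth.continuousOn.neg.sub continuousOn_const
    have h2 : ContinuousOn (fun y => (-u y - ε) ^ s) Ω :=
      h1.rpow_const fun y _ => Or.inr (by linarith)
    have h3 : Continuous fun y : EuclideanSpace ℝ (Fin n) => Real.exp (A * ‖y - p‖ ^ 2) := by
      fun_prop
    exact ((h2.mul (continuousOn_gradient h.isOpen h.smooth)).mul h3.continuousOn).mono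
      fun y hy => hy.1
  obtain ⟨z, hz, hmax⟩ := hK.exists_isMaxOn ⟨x, hx, by linarith⟩ hΦcont
  have hxz : Φ x ≤ Φ z := hmax ⟨hx, by linarith⟩
  have hzpos : 0 < Φ z → (-u z - ε) ^ s * ‖∇ u z‖ ^ 2 ≤
      gradientBound n s R (R ^ 2 / τ) N₁ N₂ D₁ D₂ := by
    intro hpos
    have hw : ε < -u z := by
      rcases hz.2.eq_or_lt with heq | hlt
      · simp only [hΦ, ← heq, sub_self, Real.zero_rpow (by linarith : s ≠ 0), zero_mul,
          lt_irrefl] at hpos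
      · exact hlt
    have hq : 0 < ‖∇ u z‖ ^ 2 := by
      refine (sq_nonneg _).lt_of_ne fun h0 => ?_
      simp only [hΦ, ← h0, mul_zero, zero_mul, lt_irrefl] at hpos
    exact h.gradient_bound_of_max hN₁ hτ hR hs hsN hA hAR hε hz.1 hw hq
      fun y hy1 hy2 => hmax ⟨hy1, hy2⟩
  have hexpz : Real.exp (A * ‖z - p‖ ^ 2) ≤ Real.exp 1 := by
    rw [Real.exp_le_exp]
    have h1 := h.norm_sub_le z (subset_closure hz.1)
    have h2 : A * ‖z - p‖ ^ 2 ≤ A * R ^ 2 := by gcongr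
    linarith
  have hΦz : Φ z ≤ gradientBound n s R (R ^ 2 / τ) N₁ N₂ D₁ D₂ * Real.exp 1 := by
    rcases le_or_gt (Φ z) 0 with h0 | h0
    · exact h0.trans (by positivity)
    · exact mul_le_mul (hzpos h0) hexpz (by positivity) hbound
  have hxε : -u x - ε = -u x / 2 := by rw [hεdef]; ring
  have h1 : (-u x / 2) ^ s * ‖∇ u x‖ ^ 2 ≤ Φ x := by
    rw [hΦ]
    simp only [hxε]
    refine le_mul_of_one_le_right (by positivity) (Real.one_le_exp (by positivity))
  have h2 : (-u x) ^ s * ‖∇ u x‖ ^ 2 = 2 ^ s * ((-u x / 2) ^ s * ‖∇ u x‖ ^ 2) := by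
    rw [Real.div_rpow hux.le (by norm_num)]
    field_simp
  rw [h2]
  exact mul_le_mul_of_nonneg_left (h1.trans (hxz.trans hΦz)) (by positivity)

end GradientEstimate

/-! ### Pointwise inequalities at a maximum of the second-derivative test function. -/

section HessianEstimate

open Filter Topology
open scoped InnerProductSpace

variable {n : ℕ}

/-- The concavity term controls the third derivatives in the directions of small eigenvalues. -/
lemma concavity_term_bound {c lam P : Fin n → ℝ} {j : Fin n} {L S : ℝ} (hc : ∀ i, 0 < c i)
    (hLj : lam j = L) (hL : 0 < L)
    (hrot : ∀ k : Fin n → ℝ, 0 ≤ S + 4 * ∑ i, (c i - c j) * k i * P i +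
      2 * ∑ i, (c i - c j) * (lam j - lam i) * k i ^ 2) :
    ∑ i, (if |lam i| < L / 2 then (4 / 3 * c i - 4 * c j) * (P i / L) ^ 2 else 0) ≤ S / L := by
  -- This kᵢ is the critical point of the quadratic polynomial in `hrot`. For |λᵢ| < L/2 the
  -- denominator lies between L/2 and 3L/2, which produces the coefficients 4 and 4/3.
  have h := hrot fun i => if |lam i| < L / 2 then -P i / (L - lam i) else 0
  rw [le_div_iff₀ hL, Finset.sum_mul]
  rw [Finset.mul_sum, Finset.mul_sum, add_assoc, ← Finset.sum_add_distrib, hLj] at h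
  have key : ∀ i, (if |lam i| < L / 2 then (4 / 3 * c i - 4 * c j) * (P i / L) ^ 2 else 0) * L ≤
      -(4 * ((c i - c j) * (if |lam i| < L / 2 then -P i / (L - lam i) else 0) * P i) +
        2 * ((c i - c j) * (L - lam i) *
          (if |lam i| < L / 2 then -P i / (L - lam i) else 0) ^ 2)) := by
    intro i
    by_cases hi : |lam i| < L / 2
    · simp only [if_pos hi]
      have h1 : L / 2 < L - lam i := by linarith [le_abs_self (lam i)]
      have h2 : L - lam i < 3 * L / 2 := by linarith [neg_abs_le (lam i)]
      have h3 : 0 < L - lam i := by linarith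
      have e : -(4 * ((c i - c j) * (-P i / (L - lam i)) * P i) +
          2 * ((c i - c j) * (L - lam i) * (-P i / (L - lam i)) ^ 2)) =
          2 * c i * (P i ^ 2 / (L - lam i)) - 2 * c j * (P i ^ 2 / (L - lam i)) := by
        field_simp
        ring
      have e' : (4 / 3 * c i - 4 * c j) * (P i / L) ^ 2 * L =
          2 * c i * (2 / 3 * (P i ^ 2 / L)) - 2 * c j * (2 * (P i ^ 2 / L)) := by
        field_simp
        ring
      have h4 : 2 / 3 * (P i ^ 2 / L) ≤ P i ^ 2 / (L - lam i) := by
        rw [← mul_div_assoc, div_le_div_iff₀ hL h3]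
        nlinarith [sq_nonneg (P i)]
      have h5 : P i ^ 2 / (L - lam i) ≤ 2 * (P i ^ 2 / L) := by
        rw [← mul_div_assoc, div_le_div_iff₀ h3 hL]
        nlinarith [sq_nonneg (P i)]
      rw [e, e']
      have h6 := mul_le_mul_of_nonneg_left h4 (hc i).le
      have h7 := mul_le_mul_of_nonneg_left h5 (hc j).le
      linarith
    · simp [if_neg hi]
  have hsum := Finset.sum_le_sum fun i (_ : i ∈ Finset.univ) => key i
  rw [Finset.sum_neg_distrib] at hsum
  linarith

lemma sq_sub_sub_le (X Y Z : ℝ) : (X - Y - Z) ^ 2 ≤ 3 * (X ^ 2 + Y ^ 2 + Z ^ 2) := by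
  nlinarith [sq_nonneg (X + Y), sq_nonneg (X + Z), sq_nonneg (Y - Z)]

lemma sq_add_add_le (X Y Z : ℝ) : (X + Y + Z) ^ 2 ≤ 3 * (X ^ 2 + Y ^ 2 + Z ^ 2) := by
  nlinarith [sq_nonneg (X - Y), sq_nonneg (X - Z), sq_nonneg (Y - Z)]

/-- Here `p` stands for u_ijj/u_jj. The first-order condition splits it into contributions of the
cutoff (X), the gradient term (Y) and the paraboloid (Z). -/
lemma exists_first_order_decomposition {lam v y p w Q R A β κ : ℝ} (hw : 0 < w)
    (hv : v ^ 2 ≤ Q) (hQ : 0 < Q) (hAR : A * R ^ 2 = 1) (hy : |y| ≤ R) (hβ : 0 < β)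
    (h1 : β * (-v / w) + p + (κ / Q * (lam * v) + A * y) = 0) :
    ∃ X Y Z : ℝ, p = X - Y - Z ∧ X ^ 2 ≤ β ^ 2 * Q / w ^ 2 ∧ Y ^ 2 ≤ κ ^ 2 * (lam ^ 2 / Q) ∧
      Z ^ 2 ≤ A ∧ β * (v ^ 2 / w ^ 2) = X ^ 2 / β := by
  refine ⟨β * v / w, κ / Q * (lam * v), A * y, ?_, ?_, ?_, ?_, ?_⟩
  · have e : β * (-v / w) = -(β * v / w) := by ring
    linarith
  · rw [div_pow, mul_pow]
    gcongr
  · have e : (κ / Q * (lam * v)) ^ 2 = κ ^ 2 * (lam ^ 2 * v ^ 2 / Q ^ 2) := by ring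
    rw [e]
    have : lam ^ 2 * v ^ 2 / Q ^ 2 ≤ lam ^ 2 / Q := by
      rw [div_le_div_iff₀ (by positivity) hQ]
      have := mul_le_mul_of_nonneg_left hv (mul_nonneg (sq_nonneg lam) hQ.le)
      linarith
    gcongr
  · have h4 : y ^ 2 ≤ R ^ 2 := sq_le_sq' (by linarith [neg_abs_le y]) (by linarith [le_abs_self y])
    have e : A ^ 2 * R ^ 2 = A := by
      have : A * (A * R ^ 2) = A := by rw [hAR, mul_one]
      linarith
    calc (A * y) ^ 2 = A ^ 2 * y ^ 2 := by ring
      _ ≤ A ^ 2 * R ^ 2 := by gcongr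
      _ = A := e
  · field_simp

/-- Concavity supplies 4/3 p² where only p² is needed. The spare third pays for the cutoff term,
because β ≥ 9 gives X²/β ≤ X²/9 ≤ (p² + Y² + Z²)/3. The second inequality bounds the price, a
multiple of `c j`, by a fraction 1/(2m) of κL²/Q. -/
lemma small_direction_bound {lam v p w Q A β κ L m X Y Z : ℝ} (hQ : 0 < Q) (hA : 0 < A)
    (hA1 : A ≤ 1) (hβ : 9 ≤ β) (hκ : 0 < κ) (hm : 1 ≤ m) (hmκ : 12 * m * κ ≤ 1)
    (hp : p = X - Y - Z) (hX : X ^ 2 ≤ β ^ 2 * Q / w ^ 2) (hY : Y ^ 2 ≤ κ ^ 2 * (lam ^ 2 / Q))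
    (hZ : Z ^ 2 ≤ A) (hXβ : β * (v ^ 2 / w ^ 2) = X ^ 2 / β)
    (hlarge : 4 * (β ^ 2 * Q / w ^ 2) + 3 ≤ κ * L ^ 2 / (48 * m * Q)) (hi : |lam| < L / 2) :
    β * (v ^ 2 / w ^ 2) ≤ 1 / 3 * p ^ 2 + κ * (lam ^ 2 / Q) + A / 2 ∧
      4 * p ^ 2 ≤ κ / (2 * m * Q) * L ^ 2 := by
  have hlQ : 0 ≤ lam ^ 2 / Q := by positivity
  constructor
  · have h4 : X ^ 2 ≤ 3 * (p ^ 2 + Y ^ 2 + Z ^ 2) := by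
      have e : X = p + Y + Z := by linarith
      rw [e]; exact sq_add_add_le p Y Z
    have h5 : X ^ 2 / β ≤ X ^ 2 / 9 := by gcongr
    have h6 : κ ^ 2 * (lam ^ 2 / Q) ≤ κ * (lam ^ 2 / Q) := by
      refine mul_le_mul_of_nonneg_right ?_ hlQ
      nlinarith
    have h7 : 0 ≤ κ * (lam ^ 2 / Q) := by positivity
    rw [hXβ]
    linarith
  · have h4 : p ^ 2 ≤ 3 * (X ^ 2 + Y ^ 2 + Z ^ 2) := by rw [hp]; exact sq_sub_sub_le X Y Z
    have h5 : lam ^ 2 ≤ L ^ 2 / 4 := by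
      have : lam ^ 2 ≤ (L / 2) ^ 2 := by
        rw [← sq_abs]; gcongr
      linarith
    have h6 : κ ^ 2 * (lam ^ 2 / Q) ≤ κ ^ 2 * (L ^ 2 / 4 / Q) := by gcongr
    have h7 : 12 * (κ ^ 2 * (L ^ 2 / 4 / Q)) ≤ κ * L ^ 2 / (4 * m * Q) := by
      have e : 12 * (κ ^ 2 * (L ^ 2 / 4 / Q)) = (12 * m * κ) * (κ * L ^ 2 / (4 * m * Q)) := by
        field_simp
      rw [e]
      exact mul_le_of_le_one_left (by positivity) hmκ
    have h8 : κ * L ^ 2 / (48 * m * Q) * 12 = κ * L ^ 2 / (4 * m * Q) := by field_simp; ring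
    have h9 : κ / (2 * m * Q) * L ^ 2 = κ * L ^ 2 / (4 * m * Q) + κ * L ^ 2 / (4 * m * Q) := by
      field_simp; ring
    have h10 : 0 ≤ β ^ 2 * Q / w ^ 2 := by positivity
    linarith

/-- When |λ| ≥ L/2 and L is large, half of the gradient term κλ²/Q dominates everything else. The
other half is kept for the top direction. -/
lemma large_direction_bound {lam v p w Q A β κ L m X Y Z : ℝ} (hQ : 0 < Q)
    (hA1 : A ≤ 1) (hβ : 9 ≤ β) (hκ : 0 < κ) (hm : 1 ≤ m) (hmκ : 12 * m * κ ≤ 1)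
    (hp : p = X - Y - Z) (hX : X ^ 2 ≤ β ^ 2 * Q / w ^ 2) (hY : Y ^ 2 ≤ κ ^ 2 * (lam ^ 2 / Q))
    (hZ : Z ^ 2 ≤ A) (hXβ : β * (v ^ 2 / w ^ 2) = X ^ 2 / β) (hL : 0 < L)
    (hlarge : 4 * (β ^ 2 * Q / w ^ 2) + 3 ≤ κ * L ^ 2 / (48 * m * Q)) (hi : L / 2 ≤ |lam|) :
    β * (v ^ 2 / w ^ 2) + p ^ 2 ≤ κ / 2 * (lam ^ 2 / Q) := by
  have hlQ : 0 ≤ lam ^ 2 / Q := by positivity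
  have h5 : L ^ 2 / 4 ≤ lam ^ 2 := by
    have : (L / 2) ^ 2 ≤ lam ^ 2 := by
      rw [← sq_abs lam]; gcongr
    linarith
  have h4 : p ^ 2 ≤ 3 * (X ^ 2 + Y ^ 2 + Z ^ 2) := by rw [hp]; exact sq_sub_sub_le X Y Z
  have h6 : X ^ 2 / β ≤ X ^ 2 := div_le_self (sq_nonneg _) (by linarith)
  have h7 : 3 * (κ ^ 2 * (lam ^ 2 / Q)) ≤ κ / 4 * (lam ^ 2 / Q) := by
    rw [← mul_assoc]
    refine mul_le_mul_of_nonneg_right ?_ hlQ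
    nlinarith
  have h8 : κ * L ^ 2 / (48 * m * Q) ≤ κ / 4 * (lam ^ 2 / Q) := by
    have h9 : κ * L ^ 2 / (48 * m * Q) ≤ κ * L ^ 2 / (48 * 1 * Q) := by gcongr
    have h10 : κ * L ^ 2 / (48 * 1 * Q) = κ / 12 * (L ^ 2 / 4 / Q) := by field_simp; ring
    have h11 : κ / 12 * (L ^ 2 / 4 / Q) ≤ κ / 4 * (lam ^ 2 / Q) := by
      have : κ / 12 ≤ κ / 4 := by linarith
      gcongr
    linarith
  rw [hXβ]
  linarith

/-- If the largest eigenvalue is large at a maximum of the auxiliary function, then the trace of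
the linearized operator is controlled there. -/
lemma trace_bound_of_large_eigenvalue {c lam v y P : Fin n → ℝ} {j : Fin n}
    {w Q R A β κ L S : ℝ} (hc : ∀ i, 0 < c i) (hw : 0 < w) (hv : ∀ i, v i ^ 2 ≤ Q) (hQ : 1 ≤ Q)
    (hA : 0 < A) (hA1 : A ≤ 1) (hAR : A * R ^ 2 = 1) (hy : ∀ i, |y i| ≤ R) (hβ : 9 ≤ β)
    (hκ : 0 < κ) (hnκ : 12 * n * κ ≤ 1) (hLj : lam j = L) (hL : 0 < L)
    (hlarge : 48 * n / κ * Q * (4 * β ^ 2 * Q / w ^ 2 + 3) ≤ L ^ 2)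
    (hrot : ∀ k : Fin n → ℝ, 0 ≤ S + 4 * ∑ i, (c i - c j) * k i * P i +
      2 * ∑ i, (c i - c j) * (lam j - lam i) * k i ^ 2)
    (h1 : ∀ i, β * (-v i / w) + P i / L + (κ / Q * (lam i * v i) + A * y i) = 0)
    (h2 : S / L + κ / Q * ∑ i, c i * lam i ^ 2 + A * ∑ i, c i ≤
      β / w + ∑ i, c i * (β * (v i ^ 2 / w ^ 2)) + ∑ i, c i * (P i / L) ^ 2) :
    A / 2 * ∑ i, c i ≤ β / w := by
  have hQ0 : 0 < Q := by linarith
  have hn : (1 : ℝ) ≤ n := by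
    have := j.pos
    exact_mod_cast this
  have h3 := concavity_term_bound hc hLj hL hrot
  -- Each small direction costs at most `δ`; all `n` together cost half of the term with index `j`
  -- in κ/Q ∑ cᵢλᵢ². In `key` the gain `n * δ` at `j` offsets the `n` losses upon summation.
  set δ := κ / (2 * n * Q) * (c j * L ^ 2) with hδ
  have hlarge' : 4 * (β ^ 2 * Q / w ^ 2) + 3 ≤ κ * L ^ 2 / (48 * n * Q) := by
    rw [le_div_iff₀ (by positivity)]
    have e : 48 * n / κ * Q * (4 * β ^ 2 * Q / w ^ 2 + 3) =
        (48 * n * Q * (4 * (β ^ 2 * Q / w ^ 2) + 3)) / κ := by ring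
    rw [e, div_le_iff₀ hκ] at hlarge
    linarith
  have hδ0 : 0 ≤ δ := by have := hc j; positivity
  have key : ∀ i, A / 2 * c i + (if i = j then n * δ else 0) - δ ≤
      (if |lam i| < L / 2 then (4 / 3 * c i - 4 * c j) * (P i / L) ^ 2 else 0) +
        κ / Q * (c i * lam i ^ 2) + A * c i - c i * (β * (v i ^ 2 / w ^ 2)) -
        c i * (P i / L) ^ 2 := by
    intro i
    have hci := hc i
    have hcj := hc j
    obtain ⟨X, Y, Z, hp, hX, hY, hZ, hXβ⟩ := exists_first_order_decomposition hw (hv i) hQ0 hAR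
      (hy i) (by linarith) (h1 i)
    by_cases hi : |lam i| < L / 2
    · have hij : i ≠ j := by
        rintro rfl
        rw [hLj, abs_of_pos hL] at hi
        linarith
      simp only [if_pos hi, if_neg hij]
      obtain ⟨h4, h5⟩ := small_direction_bound hQ0 hA hA1 hβ hκ hn hnκ hp hX hY hZ hXβ hlarge' hi
      have h6 := mul_le_mul_of_nonneg_left h4 hci.le
      have h7 := mul_le_mul_of_nonneg_left h5 hcj.le
      have e : κ / Q * (c i * lam i ^ 2) = c i * (κ * (lam i ^ 2 / Q)) := by ring
      have e' : c j * (κ / (2 * n * Q) * L ^ 2) = δ := by rw [hδ]; ring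
      rw [e'] at h7
      rw [e]
      linarith
    · simp only [if_neg hi]
      push Not at hi
      have h4 := large_direction_bound hQ0 hA1 hβ hκ hn hnκ hp hX hY hZ hXβ hL hlarge' hi
      have h5 := mul_le_mul_of_nonneg_left h4 hci.le
      have e : κ / Q * (c i * lam i ^ 2) = 2 * (c i * (κ / 2 * (lam i ^ 2 / Q))) := by ring
      have h6 : (if i = j then n * δ else 0) ≤ c i * (κ / 2 * (lam i ^ 2 / Q)) := by
        by_cases hij : i = j
        · rw [if_pos hij, hij, hLj, hδ]
          refine le_of_eq ?_
          field_simp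
        · rw [if_neg hij]; positivity
      have h7 : 0 ≤ A * c i := by positivity
      rw [e]
      linarith
  have hsum := Finset.sum_le_sum fun i (_ : i ∈ Finset.univ) => key i
  simp only [Finset.sum_add_distrib, Finset.sum_sub_distrib, ← Finset.mul_sum,
    Finset.sum_ite_eq', Finset.mem_univ, if_true, Finset.sum_const, Finset.card_univ,
    Fintype.card_fin, nsmul_eq_mul] at hsum
  linarith

end HessianEstimate

/-! ### Largest eigenvalue at a maximum point. -/

section HessianEstimate

open Filter Topology
open scoped InnerProductSpace

variable {n : ℕ}

/-- The bound for `w^β λ_max / Q` at a maximum point of the auxiliary function. -/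
noncomputable def hessianBound (n : ℕ) (β κ R C₀ N₁ N₂ D₁ D₂ : ℝ) : ℝ :=
  C₀ ^ β * |D₁| + C₀ ^ (β - 1) * Real.sqrt (48 * n / κ * (4 * β ^ 2 + 3 * C₀ ^ 2)) +
    |D₂| * N₁ * (2 * β * R ^ 2) ^ N₂ * C₀ ^ (β - N₂)

/-- The summands of `hessianBound` match three cases: L ≤ `D₁`; L² below the threshold of `htrace`;
or the trace is at most 2βR²/w, when N bounds `c j` below and D bounds L. The hypothesis `hβN` keeps
the power of `w` nonnegative. -/
lemma eigenvalue_bound_of_trace_bound {c lam : Fin n → ℝ} {j : Fin n}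
    {w Q R A β κ L C₀ N₁ N₂ D₁ D₂ : ℝ} (hw : 0 < w) (hwC : w ≤ C₀)
    (hQ : 1 ≤ Q) (hR : 0 < R) (hAR : A * R ^ 2 = 1) (hβ : 9 ≤ β) (hβN : N₂ ≤ β) (hκ : 0 < κ)
    (hN₁ : 0 < N₁) (hLj : lam j = L) (hL : 0 < L)
    (hD : ∀ i, D₁ < lam i → c i * lam i ≤ D₂)
    (hN : ∀ M, 0 < M → ∑ i, c i ≤ M → ∀ i, 1 / (N₁ * M ^ N₂) ≤ c i)
    (htrace : 48 * n / κ * Q * (4 * β ^ 2 * Q / w ^ 2 + 3) ≤ L ^ 2 → A / 2 * ∑ i, c i ≤ β / w) :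
    w ^ β * L ≤ Q * hessianBound n β κ R C₀ N₁ N₂ D₁ D₂ := by
  have hC₀ : 0 < C₀ := hw.trans_le hwC
  have hQ0 : 0 < Q := by linarith
  have t1 : 0 ≤ C₀ ^ β * |D₁| := by positivity
  have t2 : 0 ≤ C₀ ^ (β - 1) * Real.sqrt (48 * n / κ * (4 * β ^ 2 + 3 * C₀ ^ 2)) := by positivity
  have t3 : 0 ≤ |D₂| * N₁ * (2 * β * R ^ 2) ^ N₂ * C₀ ^ (β - N₂) := by positivity
  have hQle : ∀ t : ℝ, 0 ≤ t → t ≤ Q * t := fun t ht => le_mul_of_one_le_left ht hQ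
  unfold hessianBound
  rcases le_or_gt L D₁ with h1 | h1
  · have h2 : w ^ β * L ≤ C₀ ^ β * |D₁| :=
      mul_le_mul (Real.rpow_le_rpow hw.le hwC (by linarith)) (h1.trans (le_abs_self _)) hL.le
        (by positivity)
    refine h2.trans ((hQle _ t1).trans ?_)
    gcongr
    linarith
  by_cases hlarge : 48 * n / κ * Q * (4 * β ^ 2 * Q / w ^ 2 + 3) ≤ L ^ 2
  · have h2 := htrace hlarge
    have h3 : ∑ i, c i ≤ 2 * β * R ^ 2 / w := by
      have e : 2 * R ^ 2 * (A / 2 * ∑ i, c i) = (A * R ^ 2) * ∑ i, c i := by ring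
      have h4 : 2 * R ^ 2 * (A / 2 * ∑ i, c i) ≤ 2 * R ^ 2 * (β / w) := by gcongr
      rw [e, hAR, one_mul] at h4
      exact h4.trans (le_of_eq (by ring))
    have h4 := hN _ (by positivity) h3 j
    have h5 : c j * L ≤ |D₂| := by
      have := hD j (by rwa [hLj])
      rw [hLj] at this
      exact this.trans (le_abs_self _)
    have h6 : 1 / (N₁ * (2 * β * R ^ 2 / w) ^ N₂) * L ≤ |D₂| :=
      (mul_le_mul_of_nonneg_right h4 hL.le).trans h5
    rw [one_div, inv_mul_le_iff₀ (by positivity)] at h6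
    have h7 : w ^ β * L ≤ |D₂| * N₁ * (2 * β * R ^ 2) ^ N₂ * w ^ (β - N₂) := by
      refine (mul_le_mul_of_nonneg_left h6 (by positivity)).trans (le_of_eq ?_)
      rw [Real.div_rpow (by positivity) hw.le, Real.rpow_sub hw]
      field_simp
    have h8 : w ^ (β - N₂) ≤ C₀ ^ (β - N₂) := Real.rpow_le_rpow hw.le hwC (by linarith)
    have h9 : w ^ β * L ≤ |D₂| * N₁ * (2 * β * R ^ 2) ^ N₂ * C₀ ^ (β - N₂) :=
      h7.trans (by gcongr)
    refine h9.trans ((hQle _ t3).trans ?_)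
    gcongr
    linarith
  · push Not at hlarge
    have h2 : w * L ≤ Q * Real.sqrt (48 * n / κ * (4 * β ^ 2 + 3 * C₀ ^ 2)) := by
      refine le_of_sq_le_sq ?_ (by positivity)
      rw [mul_pow, mul_pow, Real.sq_sqrt (by positivity)]
      have h3 : w ^ 2 * L ^ 2 ≤ w ^ 2 * (48 * n / κ * Q * (4 * β ^ 2 * Q / w ^ 2 + 3)) := by
        gcongr
      have e : w ^ 2 * (48 * n / κ * Q * (4 * β ^ 2 * Q / w ^ 2 + 3)) =
          48 * n / κ * (4 * β ^ 2 * Q ^ 2 + 3 * (Q * w ^ 2)) := by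
        field_simp
      have h4 : Q * w ^ 2 ≤ Q ^ 2 * C₀ ^ 2 := by
        have : Q ≤ Q ^ 2 := by nlinarith
        gcongr
      have e' : Q ^ 2 * (48 * n / κ * (4 * β ^ 2 + 3 * C₀ ^ 2)) =
          48 * n / κ * (4 * β ^ 2 * Q ^ 2 + 3 * (Q ^ 2 * C₀ ^ 2)) := by ring
      rw [e']
      refine h3.trans (e.le.trans ?_)
      gcongr
    have h3 : w ^ β * L ≤ C₀ ^ (β - 1) *
        (Q * Real.sqrt (48 * n / κ * (4 * β ^ 2 + 3 * C₀ ^ 2))) := by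
      have e : w ^ β * L = w ^ (β - 1) * (w * L) := by
        rw [Real.rpow_sub hw, Real.rpow_one]; field_simp
      rw [e]
      exact mul_le_mul (Real.rpow_le_rpow hw.le hwC (by linarith)) h2 (by positivity)
        (by positivity)
    calc w ^ β * L ≤ Q * (C₀ ^ (β - 1) *
          Real.sqrt (48 * n / κ * (4 * β ^ 2 + 3 * C₀ ^ 2))) := h3.trans (le_of_eq (by ring))
      _ ≤ _ := by gcongr; linarith

variable {Ω : Set (EuclideanSpace ℝ (Fin n))} {u : EuclideanSpace ℝ (Fin n) → ℝ}
  {N₁ N₂ D₁ D₂ τ γ R : ℝ} {x p : EuclideanSpace ℝ (Fin n)}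

lemma dirDeriv_third_comm (hΩ : IsOpen Ω) (hu : ContDiffOn ℝ ∞ u Ω) (hx : x ∈ Ω)
    (a b : EuclideanSpace ℝ (Fin n)) :
    dirDeriv a (dirDeriv a (dirDeriv b u)) x = dirDeriv b (dirDeriv a (dirDeriv a u)) x := by
  rw [dirDeriv_congr hΩ (fun y hy => dirDeriv_comm hΩ hu hy a b) hx a,
    dirDeriv_comm hΩ (hu.dirDeriv hΩ a) hx]

lemma dirDeriv_fourth_comm (hΩ : IsOpen Ω) (hu : ContDiffOn ℝ ∞ u Ω) (hx : x ∈ Ω)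
    (a b : EuclideanSpace ℝ (Fin n)) :
    dirDeriv a (dirDeriv a (dirDeriv b (dirDeriv b u))) x =
      dirDeriv b (dirDeriv b (dirDeriv a (dirDeriv a u))) x := by
  rw [dirDeriv_third_comm hΩ (hu.dirDeriv hΩ b) hx]
  exact dirDeriv_congr hΩ (fun y hy => dirDeriv_third_comm hΩ hu hy a b) hx b

/-- Second derivative bound at a maximum point of the auxiliary function. -/
lemma IsLinearizable.eigenvalue_bound_of_max (h : IsLinearizable Ω u N₁ N₂ D₁ D₂ τ γ R p)
    (hN₁ : 0 < N₁) (hτ : 0 < τ) (hR : 1 ≤ R) {β κ Q A ε : ℝ} (hβ : 9 ≤ β) (hβN : N₂ ≤ β)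
    (hκ : 0 < κ) (hnκ : 12 * n * κ ≤ 1) (hQ : 1 ≤ Q) (hAR : A * R ^ 2 = 1) (hε : 0 < ε)
    (hx : x ∈ Ω) (hw : ε < -u x) (hq : ‖∇ u x‖ ^ 2 ≤ Q)
    {b : OrthonormalBasis (Fin n) ℝ (EuclideanSpace ℝ (Fin n))} {lam c : Fin n → ℝ}
    (hl : IsLinearization Ω u N₁ N₂ D₁ D₂ τ γ x b lam c) {j : Fin n} (hj : 0 < lam j)
    (hmax : ∀ y ∈ Ω, ε ≤ -u y →
      (-u y - ε) ^ β * dirDeriv (b j) (dirDeriv (b j) u) y *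
          Real.exp (κ / (2 * Q) * ‖∇ u y‖ ^ 2 + A / 2 * ‖y - p‖ ^ 2) ≤
        (-u x - ε) ^ β * dirDeriv (b j) (dirDeriv (b j) u) x *
          Real.exp (κ / (2 * Q) * ‖∇ u x‖ ^ 2 + A / 2 * ‖x - p‖ ^ 2)) :
    (-u x - ε) ^ β * lam j ≤ Q * hessianBound n β κ R (R ^ 2 / τ) N₁ N₂ D₁ D₂ := by
  have hw0 : 0 < -u x - ε := by linarith
  have hQ0 : 0 < Q := by linarith
  have hR2 : 1 ≤ R ^ 2 := one_le_pow₀ hR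
  have hA : 0 < A := by
    by_contra! hc
    nlinarith
  have hA1 : A ≤ 1 := by nlinarith
  have hsm := h.smooth
  have hjj : dirDeriv (b j) (dirDeriv (b j) u) x = lam j := by rw [hl.diag, if_pos rfl]
  have htest := fun i => log_maximum_test (W := fun y => -u y - ε)
    (P := fun y => dirDeriv (b j) (dirDeriv (b j) u) y)
    (G := fun y => κ / (2 * Q) * ‖∇ u y‖ ^ 2 + A / 2 * ‖y - p‖ ^ 2) (s := β)
    (hasJet_neg_sub h.isOpen hsm hx ε (b i))
    (hasJet_line h.isOpen ((hsm.dirDeriv h.isOpen (b j)).dirDeriv h.isOpen (b j)) hx (b i))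
    (((hasJet_norm_gradient_sq h.isOpen hsm hx hl.diag i).const_mul (κ / (2 * Q))).add
      ((hasJet_norm_sub_sq x p (b i)).const_mul (A / 2))) hw0 (by rw [hjj]; exact hj) (by
      filter_upwards [h.superlevel_mem_nhds hx hw] with y hy using hmax y hy.1 hy.2)
  simp only [hl.diag, if_true, b.norm_eq_one, one_pow, mul_one, neg_sq] at htest
  have hy : ∀ i, |⟪x - p, b i⟫_ℝ| ≤ R := by
    intro i
    refine (abs_real_inner_le_norm _ _).trans ?_
    rw [b.norm_eq_one, mul_one]
    exact h.norm_sub_le x (subset_closure hx)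
  have hC : -u x ≤ R ^ 2 / τ := h.neg_le hτ hx
  have hv : ∀ i, dirDeriv (b i) u x ^ 2 ≤ Q := by
    intro i
    refine le_trans ?_ hq
    rw [norm_gradient_sq b, sq]
    exact Finset.single_le_sum (f := fun k => dirDeriv (b k) u x * dirDeriv (b k) u x)
      (fun k _ => mul_self_nonneg _) (Finset.mem_univ i)
  refine eigenvalue_bound_of_trace_bound hw0 (by linarith) hQ (by linarith) hAR hβ hβN hκ
    hN₁ rfl hj hl.mul_le hl.lower fun hlarge => ?_
  set P : Fin n → ℝ := fun i => dirDeriv (b i) (dirDeriv (b j) (dirDeriv (b j) u)) x with hP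
  set S : ℝ := ∑ i, c i *
    dirDeriv (b i) (dirDeriv (b i) (dirDeriv (b j) (dirDeriv (b j) u))) x with hS
  refine trace_bound_of_large_eigenvalue (v := fun i => dirDeriv (b i) u x)
    (y := fun i => ⟪x - p, b i⟫_ℝ) (P := P) (S := S) hl.pos hw0 hv hQ hA hA1 hAR hy hβ hκ hnκ rfl
    hj hlarge ?_ ?_ ?_
  · intro k
    -- Moving along `b j` itself and interchanging derivatives makes exactly `S` and `P` appear.
    have h1 := plane_rotation_inequality h.isOpen hsm hx b hl.diag hl.le_sum hl.sum_eq k j (b j)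
    simp only [fun i => dirDeriv_third_comm h.isOpen hsm hx (b j) (b i),
      dirDeriv_fourth_comm h.isOpen hsm hx (b j)] at h1
    exact h1
  · intro i
    rw [← (htest i).1]
    simp only [hP]
    field_simp
  · have hsum := Finset.sum_le_sum fun i (_ : i ∈ Finset.univ) =>
      mul_le_mul_of_nonneg_left (htest i).2 (hl.pos i).le
    set w := -u x - ε with hwdef
    have e : ∀ i, c i * (β * (-lam i / w - dirDeriv (b i) u x ^ 2 / w ^ 2) +
        (dirDeriv (b i) (dirDeriv (b i) (dirDeriv (b j) (dirDeriv (b j) u))) x / lam j -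
          dirDeriv (b i) (dirDeriv (b j) (dirDeriv (b j) u)) x ^ 2 / lam j ^ 2) +
        (κ / (2 * Q) * (2 * (lam i ^ 2 + ∑ k, dirDeriv (b k) u x *
          dirDeriv (b k) (dirDeriv (b i) (dirDeriv (b i) u)) x)) + A / 2 * 2)) =
        -(β / w) * (c i * lam i) - c i * (β * (dirDeriv (b i) u x ^ 2 / w ^ 2)) +
        1 / lam j * (c i *
          dirDeriv (b i) (dirDeriv (b i) (dirDeriv (b j) (dirDeriv (b j) u))) x) -
        c i * (P i / lam j) ^ 2 + κ / Q * (c i * lam i ^ 2) +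
        κ / Q * (c i * ∑ k, dirDeriv (b k) u x *
          dirDeriv (b k) (dirDeriv (b i) (dirDeriv (b i) u)) x) + A * c i := by
      intro i
      have e1 : κ / (2 * Q) * (2 * (lam i ^ 2 + ∑ k, dirDeriv (b k) u x *
          dirDeriv (b k) (dirDeriv (b i) (dirDeriv (b i) u)) x)) =
          κ / Q * (lam i ^ 2 + ∑ k, dirDeriv (b k) u x *
          dirDeriv (b k) (dirDeriv (b i) (dirDeriv (b i) u)) x) := by
        field_simp
      rw [e1, div_pow]
      ring
    simp only [e, Finset.sum_add_distrib, Finset.sum_sub_distrib] at hsum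
    simp only [← Finset.mul_sum Finset.univ _ (κ / Q), ← Finset.mul_sum Finset.univ _ (A),
      ← Finset.mul_sum Finset.univ _ (-(β / w)), ← Finset.mul_sum Finset.univ _ (1 / lam j), ← hS, hl.sum_eq,
      hl.sum_gradient_term h.isOpen hsm hx, mul_zero, Finset.sum_const_zero, mul_one] at hsum
    have e2 : S / lam j = 1 / lam j * S := by ring
    rw [e2]
    linarith

end HessianEstimate

/-! ### Interior second derivative estimate. -/

section HessianEstimate

open Filter Topology
open scoped InnerProductSpace

variable {n : ℕ} {Ω : Set (EuclideanSpace ℝ (Fin n))} {u : EuclideanSpace ℝ (Fin n) → ℝ}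
  {N₁ N₂ D₁ D₂ τ γ R : ℝ} {x p : EuclideanSpace ℝ (Fin n)}

lemma IsLinearization.secondDeriv_le {b : OrthonormalBasis (Fin n) ℝ (EuclideanSpace ℝ (Fin n))}
    {lam c : Fin n → ℝ} (hl : IsLinearization Ω u N₁ N₂ D₁ D₂ τ γ x b lam c) (hΩ : IsOpen Ω)
    (hu : ContDiffOn ℝ ∞ u Ω) (hx : x ∈ Ω) {L : ℝ} (hL : ∀ i, lam i ≤ L)
    {ξ : EuclideanSpace ℝ (Fin n)} (hξ : ‖ξ‖ = 1) : fderiv ℝ (fderiv ℝ u) x ξ ξ ≤ L := by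
  have h1 : ∑ k, ‖⟪b k, ξ⟫_ℝ‖ ^ 2 = 1 := by rw [b.sum_sq_norm_inner_right, hξ, one_pow]
  rw [secondDeriv_expand b]
  simp only [← dirDeriv_dirDeriv hΩ hu hx, hl.diag, mul_ite, mul_zero, Finset.sum_ite_eq,
    Finset.mem_univ, if_true]
  calc ∑ k, ⟪b k, ξ⟫_ℝ * ⟪b k, ξ⟫_ℝ * lam k ≤ ∑ k, ‖⟪b k, ξ⟫_ℝ‖ ^ 2 * L := by
        refine Finset.sum_le_sum fun k _ => ?_
        rw [Real.norm_eq_abs, sq_abs, ← sq]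
        exact mul_le_mul_of_nonneg_left (hL k) (sq_nonneg _)
    _ = L := by rw [← Finset.sum_mul, h1, one_mul]

/-- The bound for `(-u)^(β + s)` times the largest eigenvalue of `D²u`. -/
noncomputable def secondDerivBound (n : ℕ) (s β R C₀ N₁ N₂ D₁ D₂ : ℝ) : ℝ :=
  2 ^ β * (C₀ ^ s + 2 ^ s * (2 ^ s * (gradientBound n s R C₀ N₁ N₂ D₁ D₂ * Real.exp 1))) *
    (hessianBound n β (1 / (12 * n)) R C₀ N₁ N₂ D₁ D₂ * Real.exp 1)

theorem IsLinearizable.hessian_estimate (h : IsLinearizable Ω u N₁ N₂ D₁ D₂ τ γ R p)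
    (hN₁ : 0 < N₁) (hτ : 0 < τ) (hR : 1 ≤ R) {s β : ℝ} (hs : 1 ≤ s) (hsN : N₂ ≤ s + 1)
    (hβ : 9 ≤ β) (hβN : N₂ ≤ β) (hx : x ∈ Ω)
    {b : OrthonormalBasis (Fin n) ℝ (EuclideanSpace ℝ (Fin n))} {lam c : Fin n → ℝ}
    (hl : IsLinearization Ω u N₁ N₂ D₁ D₂ τ γ x b lam c) {j : Fin n} (hj : 0 < lam j) :
    (-u x) ^ (β + s) * lam j ≤ secondDerivBound n s β R (R ^ 2 / τ) N₁ N₂ D₁ D₂ := by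
  have hn : (1 : ℝ) ≤ n := by exact_mod_cast j.pos
  have hR0 : 0 < R := by linarith
  have hux : 0 < -u x := by linarith [h.neg hx]
  have hC₀ : 0 < R ^ 2 / τ := by positivity
  have huC : -u x ≤ R ^ 2 / τ := h.neg_le hτ hx
  set Cg := 2 ^ s * (gradientBound n s R (R ^ 2 / τ) N₁ N₂ D₁ D₂ * Real.exp 1) with hCg
  have hCg0 : 0 ≤ Cg := by rw [hCg]; unfold gradientBound; positivity
  set κ : ℝ := 1 / (12 * n) with hκdef
  have hκ : 0 < κ := by positivity
  have hnκ : 12 * n * κ ≤ 1 := by rw [hκdef]; exact le_of_eq (by field_simp)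
  have hκ1 : κ ≤ 1 := by nlinarith
  set H := hessianBound n β κ R (R ^ 2 / τ) N₁ N₂ D₁ D₂ with hH
  have hH0 : 0 ≤ H := by rw [hH]; unfold hessianBound; positivity
  set A : ℝ := 1 / R ^ 2 with hAdef
  have hA : 0 < A := by positivity
  have hAR : A * R ^ 2 = 1 := by rw [hAdef]; field_simp
  set ε : ℝ := -u x / 2 with hεdef
  have hε : 0 < ε := by positivity
  have hεs : 0 < ε ^ s := by positivity
  -- `Q` bounds |Du|² where -u ≥ ε. It grows like (-u(x))^(-s), which is why the final exponent is β
  -- + s and not β.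
  set Q : ℝ := 1 + Cg / ε ^ s with hQdef
  have hQ : 1 ≤ Q := by rw [hQdef]; linarith [div_nonneg hCg0 hεs.le]
  have hgrad : ∀ y ∈ Ω, ε ≤ -u y → ‖∇ u y‖ ^ 2 ≤ Q := by
    intro y hy1 hy2
    have h1 := h.gradient_estimate hN₁ hτ hR0 hs hsN hy1
    have h2 : ε ^ s * ‖∇ u y‖ ^ 2 ≤ Cg := by
      refine le_trans ?_ h1
      have := Real.rpow_le_rpow hε.le hy2 (by linarith : (0 : ℝ) ≤ s)
      gcongr
    have h3 : ‖∇ u y‖ ^ 2 ≤ Cg / ε ^ s := by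
      rw [le_div_iff₀ hεs]; linarith
    linarith
  set G : EuclideanSpace ℝ (Fin n) → ℝ := fun y =>
    κ / (2 * Q) * ‖∇ u y‖ ^ 2 + A / 2 * ‖y - p‖ ^ 2 with hG
  have hK := (h.isCompact_superlevel hε).prod
    (isCompact_sphere (0 : EuclideanSpace ℝ (Fin n)) 1)
  set Φ : EuclideanSpace ℝ (Fin n) × EuclideanSpace ℝ (Fin n) → ℝ := fun y =>
    (-u y.1 - ε) ^ β * fderiv ℝ (fderiv ℝ u) y.1 y.2 y.2 * Real.exp (G y.1) with hΦ
  have hΦcont : ContinuousOn Φ ({y | y ∈ Ω ∧ ε ≤ -u y} ×ˢ Metric.sphere 0 1) := by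
    have h1 : ContinuousOn (fun y => (-u y - ε) ^ β) Ω :=
      (h.smooth.continuousOn.neg.sub continuousOn_const).rpow_const
        fun y _ => Or.inr (by linarith)
    have h2 : ContinuousOn (fderiv ℝ (fderiv ℝ u)) Ω :=
      ((h.smooth.fderiv_of_isOpen h.isOpen (m := ∞) (by simp)).fderiv_of_isOpen h.isOpen
        (m := ∞) (by simp)).continuousOn
    have h3 : ContinuousOn (fun y => Real.exp (G y)) Ω := by
      refine Real.continuous_exp.comp_continuousOn ?_
      refine ((continuousOn_gradient h.isOpen h.smooth).const_smul (κ / (2 * Q))).add ?_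
      have : Continuous fun y : EuclideanSpace ℝ (Fin n) => A / 2 * ‖y - p‖ ^ 2 := by fun_prop
      exact this.continuousOn
    have hfst : Set.MapsTo (Prod.fst : EuclideanSpace ℝ (Fin n) × EuclideanSpace ℝ (Fin n) → _)
        ({y | y ∈ Ω ∧ ε ≤ -u y} ×ˢ Metric.sphere 0 1) Ω := fun y hy => hy.1.1
    exact ((h1.comp continuousOn_fst hfst).mul (((h2.comp continuousOn_fst hfst).clm_apply
      continuousOn_snd).clm_apply continuousOn_snd)).mul (h3.comp continuousOn_fst hfst)
  have hxmem : (x, b j) ∈ {y | y ∈ Ω ∧ ε ≤ -u y} ×ˢ Metric.sphere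
      (0 : EuclideanSpace ℝ (Fin n)) 1 := ⟨⟨hx, by linarith⟩, by simp⟩
  obtain ⟨⟨z, ξ⟩, ⟨⟨hz, hzε⟩, hξ⟩, hmax⟩ := hK.exists_isMaxOn ⟨_, hxmem⟩ hΦcont
  have hξ : ‖ξ‖ = 1 := by simpa using hξ
  have hzε : ε ≤ -u z := hzε
  have hxε : -u x - ε = -u x / 2 := by rw [hεdef]; ring
  have hxval : (-u x / 2) ^ β * lam j ≤ Φ (x, b j) := by
    simp only [hΦ, hxε, ← dirDeriv_dirDeriv h.isOpen h.smooth hx, hl.diag, if_true]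
    refine le_mul_of_one_le_right (by positivity) (Real.one_le_exp ?_)
    simp only [hG]
    positivity
  have hxz : Φ (x, b j) ≤ Φ (z, ξ) := hmax hxmem
  have hzpos : 0 < Φ (z, ξ) := lt_of_lt_of_le (by positivity) (hxval.trans hxz)
  have hw : ε < -u z := by
    rcases hzε.eq_or_lt with heq | hlt
    · simp only [hΦ, ← heq, sub_self, Real.zero_rpow (by linarith : β ≠ 0), zero_mul,
        lt_irrefl] at hzpos
    · exact hlt
  obtain ⟨b', lam', c', hl'⟩ := h.exists_linearization z hz
  obtain ⟨i₀, hi₀⟩ := hl'.exists_pos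
  obtain ⟨k, -, hk⟩ := Finset.exists_max_image Finset.univ lam' ⟨i₀, Finset.mem_univ _⟩
  have hkpos : 0 < lam' k := hi₀.trans_le (hk i₀ (Finset.mem_univ _))
  have hdir : ∀ y ∈ Ω, fderiv ℝ (fderiv ℝ u) y (b' k) (b' k) =
      dirDeriv (b' k) (dirDeriv (b' k) u) y := fun y hy =>
    (dirDeriv_dirDeriv h.isOpen h.smooth hy _ _).symm
  have hwz : 0 ≤ (-u z - ε) ^ β := Real.rpow_nonneg (by linarith) _
  -- At z the direction ξ may be replaced by a top eigenvector. With that direction frozen, z still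
  -- maximizes over y, now for a function of the point alone.
  have hzk : Φ (z, ξ) ≤ (-u z - ε) ^ β * lam' k * Real.exp (G z) := by
    have := hl'.secondDeriv_le h.isOpen h.smooth hz (fun i => hk i (Finset.mem_univ _)) hξ
    simp only [hΦ]
    gcongr
  have hbound := h.eigenvalue_bound_of_max hN₁ hτ hR hβ hβN hκ hnκ hQ hAR hε hz hw
    (hgrad z hz hzε) hl' hkpos (by
      intro y hy1 hy2
      have h1 : Φ (y, b' k) ≤ Φ (z, ξ) := hmax ⟨⟨hy1, hy2⟩, by simp⟩
      have h2 := h1.trans hzk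
      simp only [hΦ, hdir y hy1] at h2
      rw [hl'.diag, if_pos rfl]
      exact h2)
  have hGz : Real.exp (G z) ≤ Real.exp 1 := by
    rw [Real.exp_le_exp]
    have h1 : κ / (2 * Q) * ‖∇ u z‖ ^ 2 ≤ κ / (2 * Q) * Q := by
      have := hgrad z hz hzε
      gcongr
    have h2 : κ / (2 * Q) * Q = κ / 2 := by field_simp
    have h3 : A / 2 * ‖z - p‖ ^ 2 ≤ A / 2 * R ^ 2 := by
      have := h.norm_sub_le z (subset_closure hz)
      gcongr
    simp only [hG]
    linarith
  have hfin : (-u x / 2) ^ β * lam j ≤ Q * H * Real.exp 1 :=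
    (hxval.trans (hxz.trans hzk)).trans (mul_le_mul hbound hGz (by positivity) (by positivity))
  have h1 : (-u x) ^ (β + s) * lam j = 2 ^ β * (-u x) ^ s * ((-u x / 2) ^ β * lam j) := by
    rw [Real.div_rpow hux.le (by norm_num), Real.rpow_add hux]
    field_simp
  have h2 : (-u x) ^ s * Q = (-u x) ^ s + 2 ^ s * Cg := by
    rw [hQdef, hεdef, Real.div_rpow hux.le (by norm_num)]
    field_simp
  have h3 : (-u x) ^ s ≤ (R ^ 2 / τ) ^ s := Real.rpow_le_rpow hux.le huC (by linarith)
  calc (-u x) ^ (β + s) * lam j ≤ 2 ^ β * (-u x) ^ s * (Q * H * Real.exp 1) := by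
        rw [h1]; gcongr
    _ = 2 ^ β * ((-u x) ^ s * Q) * (H * Real.exp 1) := by ring
    _ ≤ 2 ^ β * ((R ^ 2 / τ) ^ s + 2 ^ s * Cg) * (H * Real.exp 1) := by
        rw [h2]; gcongr

end HessianEstimate

/-! ### Linearizations built from the operator, and comparison of norms. -/

section Construction

open Filter Topology
open scoped InnerProductSpace

variable {n : ℕ} {Γ : Set (Fin n → ℝ)} {F : Matrix (Fin n) (Fin n) ℝ → ℝ}
  {f : (Fin n → ℝ) → ℝ} {Ω : Set (EuclideanSpace ℝ (Fin n))}
  {u : EuclideanSpace ℝ (Fin n) → ℝ} {x : EuclideanSpace ℝ (Fin n)}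

lemma secondDeriv_eq_sum_hessianMatrix (u : EuclideanSpace ℝ (Fin n) → ℝ)
    (x y z : EuclideanSpace ℝ (Fin n)) :
    fderiv ℝ (fderiv ℝ u) x y z = ∑ k, ∑ l, y k * z l * hessianMatrix u x k l := by
  rw [secondDeriv_expand (EuclideanSpace.basisFun (Fin n) ℝ)]
  simp [hessianMatrix, EuclideanSpace.inner_single_left]

lemma secondDeriv_eigenvectorBasis (h : (hessianMatrix u x).IsHermitian) (i j : Fin n) :
    fderiv ℝ (fderiv ℝ u) x (h.eigenvectorBasis i) (h.eigenvectorBasis j) =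
      if i = j then h.eigenvalues i else 0 := by
  rw [secondDeriv_eq_sum_hessianMatrix]
  have h1 := h.mulVec_eigenvectorBasis j
  have h2 := orthonormal_iff_ite.1 h.eigenvectorBasis.orthonormal i j
  rw [PiLp.inner_apply] at h2
  have h3 : ∀ k, ∑ l, h.eigenvectorBasis i k * h.eigenvectorBasis j l * hessianMatrix u x k l =
      h.eigenvalues j * (h.eigenvectorBasis i k * h.eigenvectorBasis j k) := by
    intro k
    have := congrFun h1 k
    rw [Matrix.mulVec, dotProduct] at this
    simp only [mul_assoc, ← Finset.mul_sum]
    rw [Finset.sum_congr rfl fun l _ => mul_comm (h.eigenvectorBasis j l) _, this]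
    simp only [Pi.smul_apply, smul_eq_mul]
    ring
  simp only [h3, ← Finset.mul_sum]
  have h4 : ∑ k, h.eigenvectorBasis i k * h.eigenvectorBasis j k = if i = j then 1 else 0 := by
    rw [← h2]
    exact Finset.sum_congr rfl fun k _ => by simp [mul_comm]
  rw [h4]
  by_cases hij : i = j <;> simp [hij]

lemma sum_sq_apply_eq (b b' : OrthonormalBasis (Fin n) ℝ (EuclideanSpace ℝ (Fin n)))
    (l : EuclideanSpace ℝ (Fin n) →L[ℝ] ℝ) : ∑ k, l (b k) ^ 2 = ∑ k, l (b' k) ^ 2 := by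
  have h : ∀ b : OrthonormalBasis (Fin n) ℝ (EuclideanSpace ℝ (Fin n)),
      ∑ k, l (b k) ^ 2 = ‖(InnerProductSpace.toDual ℝ _).symm l‖ ^ 2 := by
    intro b
    rw [← b.sum_sq_norm_inner_left]
    refine Finset.sum_congr rfl fun k _ => ?_
    rw [InnerProductSpace.toDual_symm_apply, Real.norm_eq_abs, sq_abs]
  rw [h, h]

/-- The squared length of each Hessian row can be computed in the eigenbasis, where it is at most
Λ²; there are `n` rows. -/
lemma hessianNorm_le {b : OrthonormalBasis (Fin n) ℝ (EuclideanSpace ℝ (Fin n))}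
    {lam : Fin n → ℝ}
    (hdiag : ∀ i j, fderiv ℝ (fderiv ℝ u) x (b i) (b j) = if i = j then lam i else 0)
    {Λ : ℝ} (hΛ : 0 ≤ Λ) (hlam : ∀ i, |lam i| ≤ Λ) : hessianNorm u x ≤ Real.sqrt n * Λ := by
  have h1 : ∀ i, ∑ j, hessianMatrix u x i j ^ 2 ≤ Λ ^ 2 := by
    intro i
    set e : EuclideanSpace ℝ (Fin n) := EuclideanSpace.single i 1 with he
    have h2 := sum_sq_apply_eq (EuclideanSpace.basisFun (Fin n) ℝ) b
      (fderiv ℝ (fderiv ℝ u) x e)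
    have h3 : ∀ k, fderiv ℝ (fderiv ℝ u) x e (b k) = ⟪b k, e⟫_ℝ * lam k := by
      intro k
      conv_lhs => rw [← b.sum_repr' e]
      simp only [map_sum, map_smul, sum_apply, smul_apply, smul_eq_mul, hdiag]
      simp
    have h4 : ∑ j, hessianMatrix u x i j ^ 2 =
        ∑ k, fderiv ℝ (fderiv ℝ u) x e (EuclideanSpace.basisFun (Fin n) ℝ k) ^ 2 := by
      simp [hessianMatrix, he]
    rw [h4, h2]
    have h5 : ∑ k, ‖⟪b k, e⟫_ℝ‖ ^ 2 = 1 := by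
      rw [b.sum_sq_norm_inner_right, he]; simp
    calc ∑ k, fderiv ℝ (fderiv ℝ u) x e (b k) ^ 2 ≤ ∑ k, ‖⟪b k, e⟫_ℝ‖ ^ 2 * Λ ^ 2 := by
          refine Finset.sum_le_sum fun k _ => ?_
          rw [h3, mul_pow, Real.norm_eq_abs, sq_abs, ← sq_abs (lam k)]
          have := hlam k
          gcongr
      _ = Λ ^ 2 := by rw [← Finset.sum_mul, h5, one_mul]
  rw [hessianNorm]
  have h2 : ∑ i, ∑ j, hessianMatrix u x i j ^ 2 ≤ n * Λ ^ 2 := by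
    refine (Finset.sum_le_sum fun i _ => h1 i).trans (le_of_eq ?_)
    simp
  refine (Real.sqrt_le_sqrt h2).trans (le_of_eq ?_)
  rw [Real.sqrt_mul (by positivity), Real.sqrt_sq hΛ]

/-- The ratio between the modulus of the eigenvalues and the largest eigenvalue. -/
noncomputable def eigenvalueRatio (f : (Fin n → ℝ) → ℝ) : ℝ :=
  1 + ∑ i, f 1 / partialDer f i 1

/-- Linearizing at (1, …, 1) gives 0 < f(λ) ≤ ∑ fₖ(1) λₖ, and ∑ fₖ(1) = f(1) by Euler. A very
negative eigenvalue would violate this when the others are at most Λ. -/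
lemma abs_eigenvalue_le (hΓ : IsConvexInvariantCone Γ) (hF : IsEllipticHessianOperator Γ F f)
    (hconc : IsConcaveHessianOperator Γ F) (h1 : (1 : Fin n → ℝ) ∈ Γ) {lam : Fin n → ℝ}
    (hlam : lam ∈ Γ) {Λ : ℝ} (hΛ : 0 ≤ Λ) (hle : ∀ i, lam i ≤ Λ) (i : Fin n) :
    |lam i| ≤ eigenvalueRatio f * Λ := by
  have hf1 : 0 < f 1 := hF.pos h1
  have hpd := hF.ellipticity 1 h1
  have hsum := hF.euler hΓ h1
  simp only [Pi.one_apply, mul_one] at hsum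
  have h2 := (hF.pos hlam).le.trans (hF.le_fderiv hΓ hconc h1 hlam)
  have h3 : ∑ k, partialDer f k 1 * lam k ≤ partialDer f i 1 * lam i + f 1 * Λ := by
    have h4 : ∑ k, partialDer f k 1 * (Λ - lam k) ≥ partialDer f i 1 * (Λ - lam i) :=
      Finset.single_le_sum (f := fun k => partialDer f k 1 * (Λ - lam k))
        (fun k _ => mul_nonneg (hpd k).le (by linarith [hle k])) (Finset.mem_univ i)
    simp only [mul_sub, Finset.sum_sub_distrib, ← Finset.sum_mul, hsum] at h4
    have := mul_nonneg (hpd i).le hΛ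
    linarith
  have h5 : f 1 / partialDer f i 1 ≤ ∑ k, f 1 / partialDer f k 1 :=
    Finset.single_le_sum (f := fun k => f 1 / partialDer f k 1)
      (fun k _ => div_nonneg hf1.le (hpd k).le) (Finset.mem_univ i)
  have h6 : 0 ≤ f 1 / partialDer f i 1 := div_nonneg hf1.le (hpd i).le
  have h7 : -(f 1 / partialDer f i 1 * Λ) ≤ lam i := by
    have e : partialDer f i 1 * (-(f 1 / partialDer f i 1 * Λ)) = -(f 1 * Λ) := by
      have := (hpd i).ne'
      field_simp
    refine le_of_mul_le_mul_left ?_ (hpd i)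
    rw [e]
    linarith
  unfold eigenvalueRatio
  rw [abs_le]
  constructor
  · nlinarith
  · have := hle i
    nlinarith

lemma exists_isLinearization (hΓ : IsConvexInvariantCone Γ)
    (hF : IsEllipticHessianOperator Γ F f) (hconc : IsConcaveHessianOperator Γ F)
    {N₁ N₂ D₁ D₂ : ℝ} (hN : ConditionN Γ f N₁ N₂) (h1 : (1 : Fin n → ℝ) ∈ Γ) (hΩ : IsOpen Ω)
    (hu : ContDiffOn ℝ ∞ u Ω) (hadm : IsAdmissibleOn Γ u Ω) (hD : ConditionD F f u Ω D₁ D₂)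
    (hx : x ∈ Ω) :
    ∃ b lam c, IsLinearization Ω u N₁ N₂ D₁ D₂ (f 1) (eigenvalueRatio f) x b lam c := by
  have hA := hadm.2 x hx
  have hherm : (hessianMatrix u x).IsHermitian := by
    obtain ⟨_, _, h, _⟩ := hA; exact h
  have hev : IsEigenvalueVector (hessianMatrix u x) hherm.eigenvalues := ⟨hherm, 1, rfl⟩
  have hmem := hΓ.mem_of_isEigenvalueVector hA hev
  have hf : f hherm.eigenvalues = 1 := by
    rw [← hF.eq_of_eigenvalues _ _ hmem hev, hD.1 x hx]
  refine ⟨hherm.eigenvectorBasis, hherm.eigenvalues, fun i => partialDer f i hherm.eigenvalues,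
    ?_, hF.ellipticity _ hmem, ?_, ?_, ?_, ?_, ?_, ?_⟩
  · intro i j
    rw [dirDeriv_dirDeriv hΩ hu hx, secondDeriv_eigenvectorBasis]
  · rw [hF.euler hΓ hmem, hf]
  · intro y hy r
    rw [← hD.1 y hy]
    refine (hF.le_sum_partialDer hΓ hconc hmem (hadm.2 y hy) r).trans (le_of_eq ?_)
    refine Finset.sum_congr rfl fun i _ => ?_
    rw [dirDeriv_dirDeriv hΩ hu hy, secondDeriv_eq_sum_hessianMatrix]
  -- Testing with w = (1, …, 1) gives f(1) ≤ ∑ cᵢ.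
  · have := hF.le_fderiv hΓ hconc hmem h1
    simpa using this
  · exact fun i hi => hD.2 x hx _ hev i hi
  · exact fun M hM hle i => hN.2 _ hmem hf M hM hle i
  · intro Λ hΛ i
    refine abs_eigenvalue_le hΓ hF hconc h1 hmem ?_ hΛ i
    by_contra! hneg
    have h2 : ∑ i, partialDer f i hherm.eigenvalues * hherm.eigenvalues i ≤ 0 :=
      Finset.sum_nonpos fun i _ => mul_nonpos_of_nonneg_of_nonpos
        (hF.ellipticity _ hmem i).le ((hΛ i).trans hneg.le)
    rw [hF.euler hΓ hmem, hf] at h2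
    linarith

end Construction

/-! ### The main theorem. -/

theorem theorem1p1 {n : ℕ} (Γ : Set (Fin n → ℝ)) (hΓ : IsConvexInvariantCone Γ)
    (F : Matrix (Fin n) (Fin n) ℝ → ℝ) (f : (Fin n → ℝ) → ℝ)
    (hF : IsEllipticHessianOperator Γ F f) (hconc : IsConcaveHessianOperator Γ F)
    (N₁ N₂ : ℝ) (hN : ConditionN Γ f N₁ N₂) (D₁ D₂ d : ℝ) :
    ∃ α β C : ℝ, 0 < α ∧ 0 < β ∧
      ∀ Ω : Set (EuclideanSpace ℝ (Fin n)),
        IsOpen Ω → IsConnected Ω → Bornology.IsBounded Ω → Metric.diam Ω = d →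
        ∀ u : EuclideanSpace ℝ (Fin n) → ℝ,
          ContDiffOn ℝ ∞ u Ω → ContinuousOn u (closure Ω) → IsAdmissibleOn Γ u Ω →
          (∀ x ∈ Ω, F (hessianMatrix u x) = 1) → (∀ x ∈ frontier Ω, u x = 0) →
          ConditionD F f u Ω D₁ D₂ →
          ∀ x ∈ Ω, u x < 0 ∧
            (-u x) + (-u x) ^ α * ‖∇ u x‖ + (-u x) ^ β * hessianNorm u x ≤ C := by
  by_cases hne : Γ.Nonempty
  swap
  · refine ⟨1, 1, 0, one_pos, one_pos, fun Ω _ _ _ _ u _ _ hadm _ _ _ x hx => ?_⟩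
    obtain ⟨v, hv, _⟩ := hadm.2 x hx
    exact absurd ⟨v, hv⟩ hne
  have h1 : (1 : Fin n → ℝ) ∈ Γ := hΓ.positiveOrthant_subset hne fun i => one_pos
  have hτ : 0 < f 1 := hF.pos h1
  have hγ : 0 ≤ eigenvalueRatio f := by
    unfold eigenvalueRatio
    have : 0 ≤ ∑ i, f 1 / partialDer f i 1 :=
      Finset.sum_nonneg fun i _ => div_nonneg hτ.le (hF.ellipticity 1 h1 i).le
    linarith
  -- The maximum with 1 ensures A = 1/R² ≤ 1 in the second derivative estimate.
  set R : ℝ := max 1 d with hRdef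
  have hR : 1 ≤ R := le_max_left _ _
  have hN₂ := le_abs_self N₂
  have hN₂' := abs_nonneg N₂
  -- These choices meet s ≥ 1, N₂ ≤ s + 1, β ≥ 9 and N₂ ≤ β whatever the sign of N₂.
  set s : ℝ := 1 + |N₂| with hs
  set β : ℝ := 9 + |N₂| with hβ
  set C₁ : ℝ := 2 ^ s * (gradientBound n s R (R ^ 2 / f 1) N₁ N₂ D₁ D₂ * Real.exp 1) with hC₁
  set C₂ : ℝ := secondDerivBound n s β R (R ^ 2 / f 1) N₁ N₂ D₁ D₂ with hC₂
  refine ⟨s / 2, β + s, R ^ 2 / f 1 + Real.sqrt C₁ + Real.sqrt n * (eigenvalueRatio f * C₂),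
    by positivity, by positivity, ?_⟩
  intro Ω hΩ _ hbdd hdiam u hu hcont hadm _ hbdry hD x hx
  -- The point x itself serves as the centre: the constants depend only on `R`, not on the centre.
  have hlin : IsLinearizable Ω u N₁ N₂ D₁ D₂ (f 1) (eigenvalueRatio f) R x := by
    refine ⟨hΩ, hu, hcont, hbdry,
      fun y hy => exists_isLinearization hΓ hF hconc hN h1 hΩ hu hadm hD hy, fun y hy => ?_⟩
    rw [← dist_eq_norm]
    refine (Metric.dist_le_diam_of_mem hbdd.closure hy (subset_closure hx)).trans ?_
    rw [Metric.diam_closure, hdiam]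
    exact le_max_right _ _
  have hneg := hlin.neg hx
  refine ⟨hneg, ?_⟩
  have hux : 0 < -u x := by linarith
  have e0 := hlin.neg_le hτ hx
  have e1 : (-u x) ^ (s / 2) * ‖∇ u x‖ ≤ Real.sqrt C₁ := by
    refine Real.le_sqrt_of_sq_le ?_
    have h2 := hlin.gradient_estimate hN.1 hτ (by linarith) (s := s) (by linarith) (by linarith) hx
    rw [mul_pow, ← Real.rpow_natCast, ← Real.rpow_mul hux.le]
    have e : s / 2 * ((2 : ℕ) : ℝ) = s := by push_cast; ring
    rw [e]
    exact h2
  obtain ⟨b, lam, c, hl⟩ := hlin.exists_linearization x hx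
  obtain ⟨i₀, hi₀⟩ := hl.exists_pos
  obtain ⟨j, -, hj⟩ := Finset.exists_max_image Finset.univ lam ⟨i₀, Finset.mem_univ _⟩
  have hjpos : 0 < lam j := hi₀.trans_le (hj i₀ (Finset.mem_univ _))
  have e2 : (-u x) ^ (β + s) * hessianNorm u x ≤ Real.sqrt n * (eigenvalueRatio f * C₂) := by
    have h2 := hlin.hessian_estimate hN.1 hτ hR (s := s) (β := β) (by linarith) (by linarith)
      (by linarith) (by linarith) hx hl hjpos
    have h3 := hl.abs_le (lam j) fun i => hj i (Finset.mem_univ _)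
    have h4 := hessianNorm_le (u := u) (x := x) (b := b) (lam := lam)
      (fun i j => by rw [← dirDeriv_dirDeriv hΩ hu hx, hl.diag]) (by positivity) h3
    calc (-u x) ^ (β + s) * hessianNorm u x
        ≤ (-u x) ^ (β + s) * (Real.sqrt n * (eigenvalueRatio f * lam j)) := by gcongr
      _ = Real.sqrt n * (eigenvalueRatio f * ((-u x) ^ (β + s) * lam j)) := by ring
      _ ≤ Real.sqrt n * (eigenvalueRatio f * C₂) := by gcongr
  linarith
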